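/- **Theorem.** Let $f:\mathbb R^d\to\mathbb R$ be twice differentiable and bounded below, $f^\ast=\inf f$, and let $L>0$, $L_2\ge 0$ be such that $\|\nabla f(x)-\nabla f(y)\|\le L\|x-y\|$ and $\|\nabla^2 f(x)-\nabla^2 f(y)\|_2\le L_2\|x-y\|$ for all $x,y\in\mathbb R^d$. Let $T_0=0$ and let $(T_k)_{k\ge 0}$ be random times whose increments $T_{k+1}-T_k$ are i.i.d. exponential with parameter $1$; write $dN_t=\sum_{k\ge1}\delta_{T_k}(dt)$. Let $0<\gamma\le 1/L$, $C>0$, $x_0\in\mathbb R^d$. For an integer $n\ge 8$ put $$\alpha=n^{-1/7},\qquad \eta=\sqrt{\gamma/2},\qquad \eta'=n^{-1/7}-\sqrt{\gamma/2},\qquad \gamma'=\gamma+\sqrt{\gamma/2},$$ and let the continuized Nesterov algorithm be started at $\tilde x_0=\tilde z_0=x_0$ and iterated, for $k\ge 0$ and with $\tau_k=T_{k+1}-T_k$, by $$\tilde y_k=\tilde x_k+\tfrac{\eta}{\eta+\eta'}\bigl(1-e^{-(\eta+\eta')\tau_k}\bigr)(\tilde z_k-\tilde x_k),\qquad \tilde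 x_{k+1}=\tilde y_k-\gamma\nabla f(\tilde y_k),$$ $$\tilde z_{k+1}=\tilde z_k+\eta'\,\frac{1-e^{-(\eta+\eta')\tau_k}}{\eta'+\eta e^{-(\eta+\eta')\tau_k}}(\tilde y_k-\tilde z_k)-\gamma'\nabla f(\tilde y_k).$$ For $1\le k\le n$ let $$\overline x_k=\sum_{i=1}^k\lambda_{i,k}\,\tilde y_{i-1},\qquad \lambda_{i,k}=\frac{e^{\alpha T_i}}{\sum_{j=1}^k e^{\alpha T_j}},\qquad \Delta_n=\int_{[0,T_n]}\Bigl(\int_{[0,t]}\alpha e^{\alpha(s-t)}\,dN_s\Bigr)^2dN_t ,$$ and let $\mathcal A_n$ be the event that for every $i\in\{1,\dots,n\}$ $$H_0^i\le C\,\mathbb E[H_0^i],\qquad H_1^i\le C\,\mathbb E[H_1^i],\qquad H_2^i\le C\alpha^{-1}\,\mathbb E[H_2^i],$$ where $H_0^i=\sum_{j=1}^i(T_i-T_j)e^{-\alpha(T_i-T_j)}$, $H_1^i=\sum_{j=1}^i e^{-\alpha(T_i-T_j)}$, $H_2^i=\sum_{j=1}^i(i-j)e^{-\alpha(T_i-T_j)}$.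 Set $$K=6\sqrt{\frac{2(1+\frac32)}{\gamma}}\sqrt{f(x_0)-f^\ast}+\frac{25}{2}\cdot 3^4\,C L_2\gamma\,(f(x_0)-f^\ast).$$ 1. For every $n\ge 8$, $\mathbb E[\Delta_n]>0$, the random variable below is integrable, and $$\mathbb E\Bigl[\mathbf 1_{\mathcal A_n}\min_{1\le k\le n}\|\nabla f(\overline x_k)\|\,\frac{\Delta_n}{\mathbb E[\Delta_n]}\Bigr]\le K\,n^{-4/7}.$$ 2. Consider the method that runs $n$ iterations of the algorithm and then returns a point $\tilde x$ of smallest gradient norm among $\overline x_1,\dots,\overline x_n$; its cost is the number of evaluations of $\nabla f$, those used to select $\tilde x$ included. For every $\varepsilon>0$ there is $n\ge 8$ such that the method uses at most $18+2(K/\varepsilon)^{7/4}$ gradient evaluations, which is $\mathcal O(\varepsilon^{-7/4})$ as $\varepsilon\to 0$, and its output satisfies $$\mathbb E\Bigl[\mathbf 1_{\mathcal A_n}\|\nabla f(\tilde x)\|\,\frac{\Delta_n}{\mathbb E[\Delta_n]}\Bigr]\le\varepsilon .$$ -/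

import Mathlib

open MeasureTheory ProbabilityTheory Set

noncomputable section

namespace CNA

/-! ### The continuized Nesterov algorithm along a sequence of jump times

Throughout, `t : ℕ → ℝ` is one realization of the jump times (`t 0 = 0 < t 1 < t 2 < …`). -/

/-- The parameters of the algorithm. -/
structure Params where
  η : ℝ
  η' : ℝ
  γ : ℝ
  γ' : ℝ

/-- The rate `α = n^(-1/7)`. -/
def rate (n : ℕ) : ℝ := (n : ℝ) ^ (-(1 / 7) : ℝ)

/-- `η = √(γ/2)`, `η' = n^(-1/7) - √(γ/2)`, step sizes `γ` and `γ' = γ + √(γ/2)`. -/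
def tuned (γ : ℝ) (n : ℕ) : Params where
  η := √(γ / 2)
  η' := rate n - √(γ / 2)
  γ := γ
  γ' := γ + √(γ / 2)

section Algorithm

variable {E : Type*} [NormedAddCommGroup E] [NormedSpace ℝ E]

/-- `ỹ_k` from `x̃_k = x`, `z̃_k = z` and the waiting time `τ = t_{k+1} - t_k`. -/
def yStep (p : Params) (τ : ℝ) (x z : E) : E :=
  (p.η / (p.η + p.η') * (1 - Real.exp (-(p.η + p.η') * τ))) • (z - x) + x

/-- `x̃_{k+1}` from `ỹ_k = y` and `g = ∇f(ỹ_k)`. -/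
def xStep (p : Params) (y g : E) : E := y - p.γ • g

/-- `z̃_{k+1}` from `z̃_k = z`, `ỹ_k = y`, `g = ∇f(ỹ_k)` and `τ = t_{k+1} - t_k`. -/
def zStep (p : Params) (τ : ℝ) (z y g : E) : E :=
  z + (p.η' * ((1 - Real.exp (-(p.η + p.η') * τ)) /
      (p.η' + p.η * Real.exp (-(p.η + p.η') * τ)))) • (y - z) - p.γ' • g

/-- The pair `(x̃_k, z̃_k)`, for the gradient field `G` and the start `x̃_0 = z̃_0 = x₀`. -/
def xz (p : Params) (G : E → E) (x₀ : E) (t : ℕ → ℝ) : ℕ → E × E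
  | 0 => (x₀, x₀)
  | k + 1 =>
    let s := xz p G x₀ t k
    let τ := t (k + 1) - t k
    let y := yStep p τ s.1 s.2
    (xStep p y (G y), zStep p τ s.2 y (G y))

/-- The iterate `ỹ_k`, `k ≥ 0`; it is the left limit at `t_{k+1}` of the continuized process. -/
def yt (p : Params) (G : E → E) (x₀ : E) (t : ℕ → ℝ) (k : ℕ) : E :=
  yStep p (t (k + 1) - t k) (xz p G x₀ t k).1 (xz p G x₀ t k).2

/-- The weight `λ_{i,k} = exp(α t_i) / ∑_{j=1}^k exp(α t_j)`. -/
def lam (α : ℝ) (t : ℕ → ℝ) (i k : ℕ) : ℝ :=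
  Real.exp (α * t i) / ∑ j ∈ Finset.Icc 1 k, Real.exp (α * t j)

/-- `x̄_k = ∑_{i=1}^k λ_{i,k} y_{i-1}`: the weight of time `t_i` multiplies the point `y_{i-1}`,
which is the left limit of the continuized process at `t_i`. -/
def average (α : ℝ) (t : ℕ → ℝ) (y : ℕ → E) (k : ℕ) : E :=
  ∑ i ∈ Finset.Icc 1 k, lam α t i k • y (i - 1)

/-- The averaged iterates of the algorithm. -/
def xbar (p : Params) (α : ℝ) (G : E → E) (x₀ : E) (t : ℕ → ℝ) (k : ℕ) : E :=
  average α t (yt p G x₀ t) k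

end Algorithm

/-! ### The functionals of the jump times -/

/-- The random measure `dN = ∑_{k ≥ 1} δ_{t_k}`. -/
def jumpMeasure (t : ℕ → ℝ) : Measure ℝ := Measure.sum fun k => Measure.dirac (t (k + 1))

/-- `Δ_n = ∫_{[0,t_n]} (∫_{[0,u]} α exp(α (s - u)) dN_s)² dN_u`. -/
def delta (α : ℝ) (t : ℕ → ℝ) (n : ℕ) : ℝ :=
  ∫ u in Icc 0 (t n),
    (∫ s in Icc 0 u, α * Real.exp (α * (s - u)) ∂(jumpMeasure t)) ^ 2 ∂(jumpMeasure t)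

def H0 (α : ℝ) (t : ℕ → ℝ) (i : ℕ) : ℝ :=
  ∑ j ∈ Finset.Icc 1 i, (t i - t j) * Real.exp (-α * (t i - t j))

def H1 (α : ℝ) (t : ℕ → ℝ) (i : ℕ) : ℝ :=
  ∑ j ∈ Finset.Icc 1 i, Real.exp (-α * (t i - t j))

def H2 (α : ℝ) (t : ℕ → ℝ) (i : ℕ) : ℝ :=
  ∑ j ∈ Finset.Icc 1 i, ((i : ℝ) - (j : ℝ)) * Real.exp (-α * (t i - t j))

/-- The event `A_n`, for the constant `C` and the rate `α`. -/
def goodSet {Ω : Type*} [MeasurableSpace Ω] (μ : Measure Ω) (T : ℕ → Ω → ℝ)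
    (C α : ℝ) (n : ℕ) : Set Ω :=
  {ω | ∀ i ∈ Finset.Icc 1 n,
    H0 α (fun k => T k ω) i ≤ C * ∫ ω', H0 α (fun k => T k ω') i ∂μ ∧
    H1 α (fun k => T k ω) i ≤ C * ∫ ω', H1 α (fun k => T k ω') i ∂μ ∧
    H2 α (fun k => T k ω) i ≤ C * α⁻¹ * ∫ ω', H2 α (fun k => T k ω') i ∂μ}

/-- `1_{A_n} · X · Δ_n / E[Δ_n]`, with `α = n^(-1/7)`. -/
def weighted {Ω : Type*} [MeasurableSpace Ω] (μ : Measure Ω) (T : ℕ → Ω → ℝ)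
    (C : ℝ) (n : ℕ) (X : Ω → ℝ) : Ω → ℝ :=
  (goodSet μ T C (rate n) n).indicator fun ω =>
    X ω * (delta (rate n) (fun k => T k ω) n / ∫ ω', delta (rate n) (fun k => T k ω') n ∂μ)

/-- The factor of `n^(-4/7)` in the bound; `δ` stands for `f(x₀) - inf f`. -/
def boundConst (γ C L₂ δ : ℝ) : ℝ :=
  6 * √(2 * (1 + 3 / 2) / γ) * √δ + 25 / 2 * 3 ^ 4 * C * L₂ * γ * δ

/-! ### Programs with access to a gradient oracle, and their number of gradient evaluations -/

/-- A program that may query a gradient oracle at points of `E` and returns an element of `β`. -/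
inductive GradProg (E β : Type*) where
  | ret (b : β) : GradProg E β
  | query (x : E) (next : E → GradProg E β) : GradProg E β

namespace GradProg

variable {E β β' : Type*}

def bind (m : GradProg E β) (h : β → GradProg E β') : GradProg E β' :=
  match m with
  | ret b => h b
  | query x next => query x fun g => (next g).bind h

/-- The value returned when the oracle answers with `G`. -/
def result (G : E → E) : GradProg E β → β
  | ret b => b
  | query x next => (next (G x)).result G

/-- The number of oracle calls made when the oracle answers with `G`. -/
def evals (G : E → E) : GradProg E β → ℕ
  | ret _ => 0
  | query x next => (next (G x)).evals G + 1

end GradProg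

section Program

variable {E : Type*} [NormedAddCommGroup E] [NormedSpace ℝ E]

/-- `k` iterations of the algorithm, one gradient evaluation each; the returned triple consists
of `x̃_k`, `z̃_k` and the record of `ỹ_0, …, ỹ_{k-1}`. -/
def iterations (p : Params) (x₀ : E) (t : ℕ → ℝ) : ℕ → GradProg E (E × E × (ℕ → E))
  | 0 => .ret (x₀, x₀, fun _ => 0)
  | k + 1 => (iterations p x₀ t k).bind fun s =>
      let τ := t (k + 1) - t k
      let y := yStep p τ s.1 s.2.1
      .query y fun g => .ret (xStep p y g, zStep p τ s.2.1 y g, Function.update s.2.2 k y)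

/-- A point with smallest gradient among `a 1, …, a (m+1)`, with its gradient norm. -/
def bestPoint (a : ℕ → E) : ℕ → GradProg E (E × ℝ)
  | 0 => .query (a 1) fun g => .ret (a 1, ‖g‖)
  | m + 1 => (bestPoint a m).bind fun b =>
      .query (a (m + 2)) fun g => .ret (if ‖g‖ < b.2 then (a (m + 2), ‖g‖) else b)

/-- The whole method: `n ≥ 1` iterations, then a point of smallest gradient among
`x̄_1, …, x̄_n`. -/
def program (p : Params) (α : ℝ) (x₀ : E) (t : ℕ → ℝ) (n : ℕ) : GradProg E E :=
  (iterations p x₀ t n).bind fun s =>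
    (bestPoint (average α t s.2.2) (n - 1)).bind fun b => .ret b.1

end Program

end CNA

end

open MeasureTheory ProbabilityTheory Set Filter Topology

set_option linter.unusedSectionVars false

noncomputable section

namespace CNA

/-! ### The standard exponential law -/

/-! In the variables x and v = z - x the algorithm is a heavy ball with friction α whose gradient
kicks come at the times of a Poisson clock: between jumps x' = ηv and v' = -αv, at a jump x loses
γ∇f(x) and v loses η∇f(x) (`xz_eq_chain`). Hence v is -η times the discounted sum of past gradients
(`chain_velocity`), and the discounted number of jumps h is `H1`. The weights λ are the same
discounts divided by h, so a Taylor expansion at the barycentre gives h‖∇f(x̄)‖ ≤ ‖v‖/η + L₂·spread,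
where the spread is the discounted sum of squared distances to the latest point
(`count_mul_norm_grad_average_le`). Since Δ_n is the sum of (αh)², multiplying by α²h and summing
over the jumps bounds min‖∇f(x̄)‖·Δ_n. On A_n, αh ≤ C(1+α), which is used in the spread term.

It remains to bound the means of ∑‖v‖² and of ∑ spread. The energy f(x) - m + ‖v‖²/2 gains η⟨∇f, v⟩
along the flow and loses the same term at a jump; for an exponential clock the two cancel in the
mean (`integral_sub_deriv_expMeasure_one`). What is left is the dissipation of α‖v‖² and γ/4‖∇f‖².
The spread recursion multiplies squared displacements by h, which is not bounded, so the energy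
carries the weight 1 + exp(h - 6/α). This weight controls αh, and its exponential part decreases in
the mean once h ≥ 3/α, so each step costs only a factor 1 + O(αe^{-3/α}), harmless over n = α^{-7}
steps (`sum_integral_dissipation_le`). A contraction argument then sums the spread
(`sum_integral_spread_le`).

Together E∑‖v‖² = O(1/α), E∑spread = O(α^{-4}), while E[Δ_n] is at least of order n
(`le_integral_sum_count_sq`). After Cauchy-Schwarz on the velocity term both contributions are O(α⁴)
= O(n^{-4/7}); this balance dictates α = n^{-1/7}. -/

lemma expMeasure_one_eq : expMeasure 1 =
    (volume.restrict (Ioi (0 : ℝ))).withDensity fun x => ENNReal.ofReal (Real.exp (-x)) := by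
  have h1 : expMeasure 1 = volume.withDensity
      ((Ici (0 : ℝ)).indicator fun x => ENNReal.ofReal (Real.exp (-x))) := by
    rw [expMeasure, gammaMeasure]
    congr 1
    funext x
    change exponentialPDF 1 x = _
    rw [exponentialPDF_eq, indicator_apply]
    by_cases hx : 0 ≤ x <;> simp [hx]
  rw [h1, withDensity_indicator measurableSet_Ici,
    Measure.restrict_congr_set Ioi_ae_eq_Ici.symm]

instance : IsProbabilityMeasure (expMeasure 1) := isProbabilityMeasure_expMeasure one_pos

instance : NullSingletonClass (expMeasure 1) := by
  rw [expMeasure_one_eq]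
  infer_instance

lemma ae_pos_expMeasure_one : ∀ᵐ x ∂(expMeasure 1), 0 < x := by
  rw [expMeasure_one_eq]
  exact (withDensity_absolutelyContinuous _ _) (ae_restrict_mem measurableSet_Ioi)

lemma integral_expMeasure_one (F : ℝ → ℝ) :
    ∫ x, F x ∂(expMeasure 1) = ∫ x in Ioi 0, Real.exp (-x) * F x := by
  rw [expMeasure_one_eq, integral_withDensity_eq_integral_toReal_smul (by fun_prop)
    (ae_of_all _ fun _ => ENNReal.ofReal_lt_top)]
  simp [ENNReal.toReal_ofReal, Real.exp_nonneg]

lemma integrable_expMeasure_one_iff (F : ℝ → ℝ) :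
    Integrable F (expMeasure 1) ↔ IntegrableOn (fun x => Real.exp (-x) * F x) (Ioi 0) := by
  rw [expMeasure_one_eq, integrable_withDensity_iff_integrable_smul' (by fun_prop)
    (ae_of_all _ fun _ => ENNReal.ofReal_lt_top)]
  simp [IntegrableOn, ENNReal.toReal_ofReal, Real.exp_nonneg]

/-- A memoryless clock rings at time `s`: the derivative and the value have the same weight. -/
lemma integral_sub_deriv_expMeasure_one {P P' : ℝ → ℝ} {M : ℝ}
    (hP : ∀ s, HasDerivAt P (P' s) s) (hM : ∀ s, 0 ≤ s → |P s| ≤ M)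
    (hPi : Integrable P (expMeasure 1)) (hPi' : Integrable P' (expMeasure 1)) :
    ∫ s, (P s - P' s) ∂(expMeasure 1) = P 0 := by
  rw [integral_expMeasure_one]
  have hd : ∀ s ∈ Ici (0 : ℝ), HasDerivAt (fun s => -(Real.exp (-s) * P s))
      (Real.exp (-s) * (P s - P' s)) s := by
    intro s _
    have h1 : HasDerivAt (fun s : ℝ => Real.exp (-s)) (-Real.exp (-s)) s := by
      simpa using (hasDerivAt_neg s).exp
    have h2 := (h1.mul (hP s)).neg
    exact h2.congr_deriv (by ring)
  have ht : Tendsto (fun s => -(Real.exp (-s) * P s)) atTop (𝓝 0) := by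
    have h0 : Tendsto (fun s : ℝ => Real.exp (-s) * M) atTop (𝓝 0) := by
      simpa using (Real.tendsto_exp_neg_atTop_nhds_zero).mul_const M
    refine squeeze_zero_norm' ?_ h0
    filter_upwards [eventually_ge_atTop (0 : ℝ)] with s hs
    rw [norm_neg, norm_mul, Real.norm_of_nonneg (Real.exp_nonneg _)]
    exact mul_le_mul_of_nonneg_left (hM s hs) (Real.exp_nonneg _)
  have hi : IntegrableOn (fun s => Real.exp (-s) * (P s - P' s)) (Ioi 0) :=
    (integrable_expMeasure_one_iff _).1 (hPi.sub hPi')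
  rw [integral_Ioi_of_hasDerivAt_of_tendsto' hd hi ht]
  simp

lemma integral_exp_neg_mul_expMeasure_one {α : ℝ} (hα : 0 < α) :
    ∫ s, Real.exp (-α * s) ∂(expMeasure 1) = 1 / (1 + α) := by
  rw [integral_expMeasure_one]
  have : ∀ x : ℝ, Real.exp (-x) * Real.exp (-α * x) = Real.exp ((-(1 + α)) * x) := by
    intro x; rw [← Real.exp_add]; ring_nf
  simp_rw [this]
  rw [integral_exp_mul_Ioi (by linarith)]
  field_simp
  simp

lemma integrable_sq_expMeasure_one : Integrable (fun s : ℝ => s ^ 2) (expMeasure 1) := by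
  rw [integrable_expMeasure_one_iff]
  have := Real.GammaIntegral_convergent (s := 3) (by norm_num)
  refine this.congr_fun (fun x _ => ?_) measurableSet_Ioi
  norm_num

lemma integral_sq_expMeasure_one : ∫ s, s ^ 2 ∂(expMeasure 1) = (2 : ℝ) := by
  rw [integral_expMeasure_one]
  have h := Real.Gamma_eq_integral (s := 3) (by norm_num)
  have h2 : Real.Gamma 3 = 2 := by simp
  rw [h2] at h
  rw [h]
  refine setIntegral_congr_fun measurableSet_Ioi (fun x _ => ?_)
  norm_num

/-! ### Resampling one waiting time -/

/-- `Φ` depends on the first `k` waiting times only. -/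
def Past {F : Type*} (k : ℕ) (Φ : (ℕ → ℝ) → F) : Prop :=
  ∀ s s' : ℕ → ℝ, (∀ i < k, s i = s' i) → Φ s = Φ s'

lemma Past.update {F : Type*} {k : ℕ} {Φ : (ℕ → ℝ) → F} (h : Past k Φ) (s : ℕ → ℝ) (x : ℝ) :
    Φ (Function.update s k x) = Φ s :=
  h _ _ fun _ hi => Function.update_of_ne hi.ne _ _

section Resample

variable {Ω : Type*} [MeasurableSpace Ω] {μ : Measure Ω} [IsProbabilityMeasure μ]
  {τ : ℕ → Ω → ℝ}

/-- An i.i.d. sequence of standard exponential waiting times. -/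
structure IsPoissonClock (μ : Measure Ω) (τ : ℕ → Ω → ℝ) : Prop where
  meas : ∀ k, Measurable (τ k)
  indep : iIndepFun τ μ
  law : ∀ k, μ.map (τ k) = expMeasure 1

lemma IsPoissonClock.integral_resample (hτ : IsPoissonClock μ τ) {k : ℕ} {Φ : (ℕ → ℝ) → ℝ}
    (hΦm : Measurable Φ) (hΦ : Past (k + 1) Φ) (hi : Integrable (fun ω => Φ fun i => τ i ω) μ) :
    Integrable (fun ω => ∫ x, Φ (Function.update (fun i => τ i ω) k x) ∂(expMeasure 1)) μ ∧
    ∫ ω, Φ (fun i => τ i ω) ∂μ =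
      ∫ ω, ∫ x, Φ (Function.update (fun i => τ i ω) k x) ∂(expMeasure 1) ∂μ := by
  let R : Ω → (Finset.range k → ℝ) := fun ω j => τ j.1 ω
  -- All coordinates from `k` on receive the new waiting time; this is harmless because `Φ` sees
  -- only the first `k + 1` of them.
  let Ψ : (Finset.range k → ℝ) × ℝ → ℝ := fun p =>
    Φ fun i => if h : i ∈ Finset.range k then p.1 ⟨i, h⟩ else p.2
  have hR : Measurable R := measurable_pi_lambda _ fun _ => hτ.meas _
  have hΨm : Measurable Ψ := by
    refine hΦm.comp (measurable_pi_lambda _ fun i => ?_)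
    by_cases h : i ∈ Finset.range k
    · simp only [h, dite_true]
      exact (measurable_pi_apply _).comp measurable_fst
    · simp only [h, dite_false]
      exact measurable_snd
  have hΨu : ∀ ω x, Ψ (R ω, x) = Φ (Function.update (fun i => τ i ω) k x) := by
    intro ω x
    refine hΦ _ _ fun i hi => ?_
    rcases Nat.lt_succ_iff_lt_or_eq.1 hi with h | h
    · simp [h, h.ne, R]
    · simp [h]
  have hΨ : ∀ ω, Ψ (R ω, τ k ω) = Φ fun i => τ i ω := by
    intro ω
    rw [hΨu]
    congr 1
    exact Function.update_eq_self k _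
  have hind : IndepFun R (τ k) μ := by
    have h := hτ.indep.indepFun_finset (Finset.range k) {k} (by simp) hτ.meas
    exact h.comp (φ := id) (ψ := fun a : (({k} : Finset ℕ) → ℝ) => a ⟨k, by simp⟩)
      measurable_id (measurable_pi_apply _)
  have hmap : μ.map (fun ω => (R ω, τ k ω)) = (μ.map R).prod (expMeasure 1) := by
    rw [← hτ.law k]
    exact (indepFun_iff_map_prod_eq_prod_map_map hR.aemeasurable (hτ.meas k).aemeasurable).1 hind
  have hpair : Measurable fun ω => (R ω, τ k ω) := hR.prodMk (hτ.meas k)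
  have := Measure.isProbabilityMeasure_map (μ := μ) hR.aemeasurable
  have hint : Integrable Ψ ((μ.map R).prod (expMeasure 1)) := by
    rw [← hmap, integrable_map_measure hΨm.aestronglyMeasurable hpair.aemeasurable]
    exact hi.congr (ae_of_all _ fun ω => (hΨ ω).symm)
  have h1 := hint.integral_prod_left
  constructor
  · have h2 := (integrable_map_measure h1.aestronglyMeasurable hR.aemeasurable).1 h1
    refine h2.congr (ae_of_all _ fun ω => ?_)
    simp only [Function.comp, hΨu]
  · calc ∫ ω, Φ (fun i => τ i ω) ∂μ = ∫ ω, Ψ (R ω, τ k ω) ∂μ := by simp_rw [hΨ]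
      _ = ∫ p, Ψ p ∂((μ.map R).prod (expMeasure 1)) := by
        rw [← hmap, integral_map hpair.aemeasurable hΨm.aestronglyMeasurable]
      _ = ∫ r, ∫ x, Ψ (r, x) ∂(expMeasure 1) ∂(μ.map R) := integral_prod _ hint
      _ = ∫ ω, ∫ x, Ψ (R ω, x) ∂(expMeasure 1) ∂μ :=
        integral_map hR.aemeasurable h1.aestronglyMeasurable
      _ = _ := by simp_rw [hΨu]

lemma IsPoissonClock.ae_pos (hτ : IsPoissonClock μ τ) : ∀ᵐ ω ∂μ, ∀ k, 0 < τ k ω := by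
  rw [ae_all_iff]
  intro k
  have h := ae_pos_expMeasure_one
  rw [← hτ.law k] at h
  exact ae_of_ae_map (hτ.meas k).aemeasurable h

/-- The update of z̃ divides by η' + ηe^{-ατ}, where η' may be negative; the denominator vanishes
for at most one value of τ, which has to be discarded. -/
lemma IsPoissonClock.ae_ne (hτ : IsPoissonClock μ τ) (c : ℝ) : ∀ᵐ ω ∂μ, ∀ k, τ k ω ≠ c := by
  rw [ae_all_iff]
  intro k
  have h : ∀ᵐ x ∂(expMeasure 1), x ≠ c := by
    rw [ae_iff]; simp
  rw [← hτ.law k] at h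
  exact ae_of_ae_map (hτ.meas k).aemeasurable h

/-! ### Measurable functions of the waiting times that are bounded on nonnegative sequences -/

/-- Measurable, and bounded on the sequences of nonnegative waiting times. -/
def Tame {F : Type*} [NormedAddCommGroup F] [MeasurableSpace F] (Φ : (ℕ → ℝ) → F) : Prop :=
  Measurable Φ ∧ ∃ M : ℝ, ∀ s : ℕ → ℝ, (∀ i, 0 ≤ s i) → ‖Φ s‖ ≤ M

namespace Tame

variable {F F' : Type*} [NormedAddCommGroup F] [MeasurableSpace F] [BorelSpace F]
  [NormedAddCommGroup F'] [MeasurableSpace F'] [BorelSpace F']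

lemma const (c : F) : Tame fun _ => c := ⟨measurable_const, ‖c‖, fun _ _ => le_rfl⟩

lemma comp [ProperSpace F] {Φ : (ℕ → ℝ) → F} (hΦ : Tame Φ) {G : F → F'} (hG : Continuous G) :
    Tame fun s => G (Φ s) := by
  obtain ⟨hm, M, hM⟩ := hΦ
  refine ⟨hG.measurable.comp hm, ?_⟩
  obtain ⟨M', hM'⟩ := (isCompact_closedBall (0 : F) M).exists_bound_of_continuousOn hG.continuousOn
  exact ⟨M', fun s hs => hM' _ (by simpa using hM s hs)⟩

lemma prodMk [SecondCountableTopology F] [SecondCountableTopology F']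
    {Φ : (ℕ → ℝ) → F} {Ψ : (ℕ → ℝ) → F'} (hΦ : Tame Φ) (hΨ : Tame Ψ) :
    Tame fun s => (Φ s, Ψ s) := by
  obtain ⟨hm, M, hM⟩ := hΦ
  obtain ⟨hm', M', hM'⟩ := hΨ
  exact ⟨hm.prodMk hm', max M M', fun s hs => max_le_max (hM s hs) (hM' s hs)⟩

lemma comp₂ [ProperSpace F] [ProperSpace F'] {F'' : Type*} [NormedAddCommGroup F'']
    [MeasurableSpace F''] [BorelSpace F''] {Φ : (ℕ → ℝ) → F} {Ψ : (ℕ → ℝ) → F'}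
    (hΦ : Tame Φ) (hΨ : Tame Ψ) {G : F → F' → F''} (hG : Continuous fun p : F × F' => G p.1 p.2) :
    Tame fun s => G (Φ s) (Ψ s) :=
  (hΦ.prodMk hΨ).comp hG

lemma sum {ι : Type*} (S : Finset ι) {Φ : ι → (ℕ → ℝ) → ℝ} (h : ∀ i ∈ S, Tame (Φ i)) :
    Tame fun s => ∑ i ∈ S, Φ i s := by
  classical
  induction S using Finset.induction_on with
  | empty => simpa using Tame.const (0 : ℝ)
  | insert i S hi ih =>
    simp_rw [Finset.sum_insert hi]
    exact (h i (Finset.mem_insert_self i S)).comp₂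
      (ih fun j hj => h j (Finset.mem_insert_of_mem hj)) continuous_add

lemma mul {Φ Ψ : (ℕ → ℝ) → ℝ} (hΦ : Tame Φ) (hΨ : Tame Ψ) : Tame fun s => Φ s * Ψ s :=
  hΦ.comp₂ hΨ continuous_mul

lemma const_mul {Φ : (ℕ → ℝ) → ℝ} (hΦ : Tame Φ) (c : ℝ) : Tame fun s => c * Φ s :=
  (Tame.const c).mul hΦ

lemma add {Φ Ψ : (ℕ → ℝ) → ℝ} (hΦ : Tame Φ) (hΨ : Tame Ψ) : Tame fun s => Φ s + Ψ s :=
  hΦ.comp₂ hΨ continuous_add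

lemma pow {Φ : (ℕ → ℝ) → ℝ} (hΦ : Tame Φ) (m : ℕ) : Tame fun s => Φ s ^ m :=
  hΦ.comp (continuous_pow m)

lemma exp_wait {α : ℝ} (hα : 0 ≤ α) (k : ℕ) : Tame fun s => Real.exp (-α * s k) := by
  refine ⟨by fun_prop, 1, fun s hs => ?_⟩
  rw [Real.norm_of_nonneg (Real.exp_nonneg _), Real.exp_le_one_iff]
  nlinarith [hs k, mul_nonneg hα (hs k)]

lemma integrable {Φ : (ℕ → ℝ) → ℝ} (hΦ : Tame Φ) (hτ : IsPoissonClock μ τ) :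
    Integrable (fun ω => Φ fun i => τ i ω) μ := by
  obtain ⟨hm, M, hM⟩ := hΦ
  refine Integrable.of_bound
    (hm.comp (measurable_pi_lambda _ hτ.meas)).aestronglyMeasurable M ?_
  filter_upwards [hτ.ae_pos] with ω hω
  exact hM _ fun i => (hω i).le

end Tame

/-- To bound the mean of a function of `k + 1` waiting times, average over the last one first. -/
lemma IsPoissonClock.integral_le_of_resample (hτ : IsPoissonClock μ τ) {k : ℕ}
    {Φ B : (ℕ → ℝ) → ℝ} (hΦt : Tame Φ) (hΦ : Past (k + 1) Φ) (hB : Tame B)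
    (h : ∀ s : ℕ → ℝ, (∀ i, 0 ≤ s i) → ∫ x, Φ (Function.update s k x) ∂(expMeasure 1) ≤ B s) :
    ∫ ω, Φ (fun i => τ i ω) ∂μ ≤ ∫ ω, B (fun i => τ i ω) ∂μ := by
  obtain ⟨h1, h2⟩ := hτ.integral_resample hΦt.1 hΦ (hΦt.integrable hτ)
  rw [h2]
  refine integral_mono_ae h1 (hB.integrable hτ) ?_
  filter_upwards [hτ.ae_pos] with ω hω
  exact h _ fun i => (hω i).le

lemma IsPoissonClock.integral_exp_mul (hτ : IsPoissonClock μ τ) {k : ℕ} {Φ : (ℕ → ℝ) → ℝ}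
    (hΦt : Tame Φ) (hΦ : Past k Φ) {α : ℝ} (hα : 0 < α) :
    ∫ ω, Real.exp (-α * τ k ω) * Φ (fun i => τ i ω) ∂μ =
      1 / (1 + α) * ∫ ω, Φ (fun i => τ i ω) ∂μ := by
  have ht : Tame fun s => Real.exp (-α * s k) * Φ s := (Tame.exp_wait hα.le k).mul hΦt
  have hp : Past (k + 1) fun s => Real.exp (-α * s k) * Φ s := by
    intro s s' hs
    simp only [hs k k.lt_succ_self, hΦ s s' fun i hi => hs i (hi.trans k.lt_succ_self)]
  obtain ⟨-, h⟩ := hτ.integral_resample ht.1 hp (ht.integrable hτ)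
  rw [h]
  simp_rw [hΦ.update, Function.update_self, integral_mul_const,
    integral_exp_neg_mul_expMeasure_one hα, integral_const_mul]

end Resample

/-! ### Functions of a decaying exponential of the clock -/

lemma exists_bound_comp_exp {α : ℝ} (hα : 0 ≤ α) {g : ℝ → ℝ} (hg : Continuous g) :
    ∃ M, ∀ s, 0 ≤ s → |g (Real.exp (-α * s))| ≤ M := by
  obtain ⟨M, hM⟩ := (isCompact_Icc (a := (0 : ℝ)) (b := 1)).exists_bound_of_continuousOn
    hg.continuousOn
  refine ⟨M, fun s hs => hM _ ⟨(Real.exp_nonneg _), ?_⟩⟩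
  rw [Real.exp_le_one_iff]
  nlinarith [mul_nonneg hα hs]

lemma integrable_comp_exp {α : ℝ} (hα : 0 ≤ α) {g : ℝ → ℝ} (hg : Continuous g) :
    Integrable (fun s => g (Real.exp (-α * s))) (expMeasure 1) := by
  obtain ⟨M, hM⟩ := exists_bound_comp_exp hα hg
  refine Integrable.of_bound (hg.comp (by fun_prop)).aestronglyMeasurable M ?_
  filter_upwards [ae_pos_expMeasure_one] with s hs
  exact hM s hs.le

/-! ### The descent lemma -/

section Analysis

variable {E : Type*} [NormedAddCommGroup E] [InnerProductSpace ℝ E] [CompleteSpace E]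

lemma descent {f : E → ℝ} {G : E → E} (hfG : ∀ x, HasGradientAt f (G x) x) {L γ : ℝ}
    (hG : ∀ x y, ‖G x - G y‖ ≤ L * ‖x - y‖) (hγ : 0 ≤ γ) (hγL : L * γ ≤ 1) (y : E) :
    f (y - γ • G y) ≤ f y - γ / 2 * ‖G y‖ ^ 2 := by
  set g := G y
  -- Up to a constant, `p` is f minus its quadratic upper model along the ray, so the Lipschitz
  -- gradient makes it nonincreasing.
  let p : ℝ → ℝ := fun s => f (y - s • g) + s * ‖g‖ ^ 2 - L * s ^ 2 / 2 * ‖g‖ ^ 2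
  have hp : ∀ s, HasDerivAt p (-inner ℝ (G (y - s • g)) g + ‖g‖ ^ 2 - L * s * ‖g‖ ^ 2) s := by
    intro s
    have h1 : HasDerivAt (fun s : ℝ => y - s • g) (-g) s := by
      simpa using ((hasDerivAt_id s).smul_const g).const_sub y
    have h2 := (hfG (y - s • g)).hasFDerivAt.comp_hasDerivAt s h1
    have h3 := (h2.add ((hasDerivAt_id s).mul_const (‖g‖ ^ 2))).sub
      ((((hasDerivAt_id s).pow 2).const_mul L).div_const 2 |>.mul_const (‖g‖ ^ 2))
    refine h3.congr_deriv ?_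
    simp
    left
    ring
  have hle : p γ ≤ p 0 := by
    refine antitoneOn_of_deriv_nonpos (convex_Ici (0 : ℝ))
      (fun s _ => (hp s).continuousAt.continuousWithinAt)
      (fun s _ => (hp s).differentiableAt.differentiableWithinAt) ?_
      (by simp : (0 : ℝ) ∈ Ici (0 : ℝ)) hγ hγ
    intro s hs
    rw [interior_Ici] at hs
    have hs : 0 < s := hs
    rw [(hp s).deriv]
    have h1 : ‖g - G (y - s • g)‖ ≤ L * (s * ‖g‖) := by
      have := hG y (y - s • g)
      rwa [sub_sub_cancel, norm_smul, Real.norm_of_nonneg hs.le] at this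
    have h2 : inner ℝ (g - G (y - s • g)) g ≤ ‖g - G (y - s • g)‖ * ‖g‖ := real_inner_le_norm _ _
    rw [inner_sub_left, real_inner_self_eq_norm_sq] at h2
    nlinarith [norm_nonneg g]
  simp only [p, zero_smul, sub_zero] at hle
  nlinarith [mul_nonneg hγ (sq_nonneg ‖g‖),
    mul_nonneg (mul_nonneg hγ (sub_nonneg.2 hγL)) (sq_nonneg ‖g‖)]

/-! ### The process `(x, v, h)` with `v = z - x` and `h` the discounted number of jumps -/

/-- The process between two jumps, `r = exp (-α s)` after the time `s`. -/
def flow (α η r : ℝ) (q : E × E × ℝ) : E × E × ℝ :=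
  (q.1 + (η / α * (1 - r)) • q.2.1, r • q.2.1, r * q.2.2)

/-- The process at a jump. -/
def jump (γ η : ℝ) (G : E → E) (q : E × E × ℝ) : E × E × ℝ :=
  (q.1 - γ • G q.1, q.2.1 - η • G q.1, q.2.2 + 1)

/-- The factor 1/2 makes the cross term η⟨∇f, v⟩ created by the flow equal to the one removed at a
jump. -/
def energy (f : E → ℝ) (m : ℝ) (q : E × E × ℝ) : ℝ := f q.1 - m + ‖q.2.1‖ ^ 2 / 2

/-- A weight that is large only when the discounted number of jumps exceeds `6 / α`. -/
def weight (α h : ℝ) : ℝ := 1 + Real.exp (h - 6 / α)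

/-- Friction acts before the jump and is weighted at h; the descent happens at the jump and is
weighted at h + 1. -/
def dissipation (α γ : ℝ) (G : E → E) (q : E × E × ℝ) : ℝ :=
  α * weight α q.2.2 * ‖q.2.1‖ ^ 2 + γ / 4 * weight α (q.2.2 + 1) * ‖G q.1‖ ^ 2

/-- The maximum over h of e^{h - 6/α}(3 - αh), attained at h = 3/α - 1. -/
def growth (α : ℝ) : ℝ := Real.exp (-6 / α) * (α * Real.exp (3 / α - 1))

lemma one_le_weight (α h : ℝ) : 1 ≤ weight α h := by
  unfold weight; linarith [Real.exp_nonneg (h - 6 / α)]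

lemma growth_nonneg {α : ℝ} (hα : 0 ≤ α) : 0 ≤ growth α := by
  unfold growth; positivity

/-- Tangent line of the exponential at 0. This is how the weighted dissipation pays for a factor h.
-/
lemma mul_add_one_le_weight {α h : ℝ} (hα : 0 < α) (hα1 : α ≤ 1) :
    α * (h + 1) ≤ 6 * weight α h := by
  have h1 := Real.add_one_le_exp (h - 6 / α)
  have h2 : α * (6 / α) = 6 := by field_simp
  have h3 := mul_le_mul_of_nonneg_left h1 hα.le
  have h4 := Real.exp_nonneg (h - 6 / α)
  unfold weight
  nlinarith

lemma weight_mono {α h h' : ℝ} (hh : h ≤ h') : weight α h ≤ weight α h' := by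
  unfold weight
  gcongr

/-- The exponential part of the weight outgrows its decay only by a tiny amount. -/
lemma exp_mul_sub_le_growth {α h : ℝ} (hα : 0 < α) :
    Real.exp (h - 6 / α) * (3 - α * h) ≤ growth α := by
  have h1 := Real.add_one_le_exp (3 / α - h - 1)
  have h2 : (3 - α * h) = α * (3 / α - h - 1 + 1) := by field_simp; ring
  have h3 : growth α = Real.exp (h - 6 / α) * (α * Real.exp (3 / α - h - 1)) := by
    rw [growth, mul_left_comm, ← Real.exp_add, mul_left_comm, ← Real.exp_add]
    ring_nf
  rw [h3, h2]
  gcongr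

/-- Young's inequality with u = ηa: ub ≤ (b²/2 + u²)/√2, and 18/25 is a rational just above 1/√2.
That it is below 1 is what matters later. -/
lemma inner_le_energy {η γ φ a b c : ℝ} (hγ : 0 < γ) (hη : η = √(γ / 2))
    (hc : |c| ≤ a * b) (hφ : b ^ 2 / 2 + γ / 2 * a ^ 2 ≤ φ) : |η * c| ≤ 18 / 25 * φ := by
  have hη0 : 0 ≤ η := hη ▸ Real.sqrt_nonneg _
  have hη2 : η ^ 2 = γ / 2 := by rw [hη]; exact Real.sq_sqrt (by positivity)
  rw [abs_mul, abs_of_nonneg hη0]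
  have h1 : η * |c| ≤ η * a * b := by nlinarith
  have h2 : η * a * b ≤ 18 / 25 * (b ^ 2 / 2 + (η * a) ^ 2) := by
    nlinarith [sq_nonneg (b - 25 / 18 * (η * a)), sq_nonneg (η * a),
      sq_nonneg b]
  nlinarith

variable {f : E → ℝ} {G : E → E} {α γ η m : ℝ}

lemma grad_sq_le (hdesc : ∀ y, f (y - γ • G y) ≤ f y - γ / 2 * ‖G y‖ ^ 2) (hm : ∀ x, m ≤ f x)
    (q : E × E × ℝ) : ‖q.2.1‖ ^ 2 / 2 + γ / 2 * ‖G q.1‖ ^ 2 ≤ energy f m q := by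
  have h1 := hdesc q.1
  have h2 := hm (q.1 - γ • G q.1)
  unfold energy
  linarith

/-- The descent step gains γ/2‖∇f‖², and the kick to v costs η²/2‖∇f‖², which is half of that. -/
lemma energy_jump_le (hγ : 0 < γ) (hη : η = √(γ / 2))
    (hdesc : ∀ y, f (y - γ • G y) ≤ f y - γ / 2 * ‖G y‖ ^ 2) (q : E × E × ℝ) :
    energy f m (jump γ η G q) ≤
      energy f m q - η * inner ℝ (G q.1) q.2.1 - γ / 4 * ‖G q.1‖ ^ 2 := by
  have hη2 : η ^ 2 = γ / 2 := by rw [hη]; exact Real.sq_sqrt (by positivity)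
  have h1 := hdesc q.1
  simp only [energy, jump]
  rw [norm_sub_sq_real, inner_smul_right, norm_smul, mul_pow, Real.norm_eq_abs, sq_abs, hη2,
    real_inner_comm]
  linarith

/-- Derivative of the energy along the flow. -/
def energyRate (α η : ℝ) (G : E → E) (q : E × E × ℝ) : ℝ :=
  η * inner ℝ (G q.1) q.2.1 - α * ‖q.2.1‖ ^ 2

lemma hasDerivAt_energy_flow (hfG : ∀ x, HasGradientAt f (G x) x) (hα : α ≠ 0)
    (q : E × E × ℝ) (s : ℝ) :
    HasDerivAt (fun s => energy f m (flow α η (Real.exp (-α * s)) q))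
      (energyRate α η G (flow α η (Real.exp (-α * s)) q)) s := by
  have he : HasDerivAt (fun s : ℝ => Real.exp (-α * s)) (-α * Real.exp (-α * s)) s := by
    have := ((hasDerivAt_id s).const_mul (-α)).exp
    exact this.congr_deriv (by simp; ring)
  have hy : HasDerivAt (fun s : ℝ => (flow α η (Real.exp (-α * s)) q).1)
      (η • (flow α η (Real.exp (-α * s)) q).2.1) s := by
    have := ((((he.const_sub 1).const_mul (η / α)).smul_const q.2.1).const_add q.1)
    refine this.congr_deriv ?_
    simp only [flow, smul_smul]
    congr 1
    field_simp
  have h1 := (hfG _).hasFDerivAt.comp_hasDerivAt s hy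
  have h2 := ((he.pow 2).mul_const (‖q.2.1‖ ^ 2)).div_const 2
  have h3 := (h1.sub_const m).add h2
  have h4 : (fun s => energy f m (flow α η (Real.exp (-α * s)) q)) = fun s =>
      (f ∘ fun s => (flow α η (Real.exp (-α * s)) q).1) s - m +
        Real.exp (-α * s) ^ 2 * ‖q.2.1‖ ^ 2 / 2 := by
    funext s
    simp [energy, flow, norm_smul, mul_pow]
  rw [h4]
  refine h3.congr_deriv ?_
  simp only [energyRate, flow, norm_smul, InnerProductSpace.toDual_apply_apply, inner_smul_right,
    mul_pow, Real.norm_eq_abs, sq_abs]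
  ring

lemma continuous_flow (q : E × E × ℝ) : Continuous fun r => flow α η r q := by
  unfold flow; fun_prop

lemma continuous_energy (hf : Continuous f) : Continuous (energy f m) := by
  unfold energy; fun_prop

lemma continuous_weight : Continuous (weight α) := by
  unfold weight; fun_prop

lemma continuous_energyRate (hG : Continuous G) : Continuous (energyRate α η G) := by
  unfold energyRate; fun_prop

lemma continuous_dissipation (hG : Continuous G) : Continuous (dissipation α γ G) := by
  have := continuous_weight (α := α)
  unfold dissipation; fun_prop

lemma continuous_jump (hG : Continuous G) : Continuous (jump γ η G) := by
  unfold jump; fun_prop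

lemma flow_one (q : E × E × ℝ) : flow α η 1 q = q := by
  simp [flow]

/-- The energy grows at a rate at most 18/25 of itself, less than the rate 1 of the clock. The clock
identity therefore bounds 7/25 of the mean by the initial value, and 25/7 ≤ 4. -/
lemma integral_energy_flow_le (hfG : ∀ x, HasGradientAt f (G x) x) (hG : Continuous G)
    (hα : 0 < α) (hγ : 0 < γ) (hη : η = √(γ / 2))
    (hdesc : ∀ y, f (y - γ • G y) ≤ f y - γ / 2 * ‖G y‖ ^ 2) (hm : ∀ x, m ≤ f x)
    (q : E × E × ℝ) :
    ∫ s, energy f m (flow α η (Real.exp (-α * s)) q) ∂(expMeasure 1) ≤ 4 * energy f m q := by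
  have hf : Continuous f := continuous_iff_continuousAt.2 fun x => (hfG x).continuousAt
  have c1 := (continuous_energy (m := m) hf).comp (continuous_flow (α := α) (η := η) q)
  have c2 := (continuous_energyRate (α := α) (η := η) hG).comp (continuous_flow (α := α) (η := η) q)
  obtain ⟨M, hM⟩ := exists_bound_comp_exp hα.le c1
  have i1 := integrable_comp_exp hα.le c1
  have i2 := integrable_comp_exp hα.le c2
  have h := integral_sub_deriv_expMeasure_one (hasDerivAt_energy_flow (m := m) hfG hα.ne' q)
    hM i1 i2
  simp only [mul_zero, Real.exp_zero, flow_one] at h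
  have hle : ∫ s, 7 / 25 * energy f m (flow α η (Real.exp (-α * s)) q) ∂(expMeasure 1) ≤
      energy f m q := by
    rw [← h]
    refine integral_mono (i1.const_mul _) (i1.sub i2) fun s => ?_
    have h1 := grad_sq_le hdesc hm (flow α η (Real.exp (-α * s)) q)
    have h2 := inner_le_energy hγ hη (abs_real_inner_le_norm _ _) h1
    have h3 := le_abs_self (η * inner ℝ (G (flow α η (Real.exp (-α * s)) q).1)
      (flow α η (Real.exp (-α * s)) q).2.1)
    simp only [energyRate]
    nlinarith [mul_nonneg hα.le (sq_nonneg ‖(flow α η (Real.exp (-α * s)) q).2.1‖)]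
  rw [integral_const_mul] at hle
  have h0 : 0 ≤ energy f m q := le_trans (by positivity) (grad_sq_le hdesc hm q)
  linarith

/-- The parenthesis on the right is the derivative of weight times energy along the flow, so the
right side integrates to its initial value plus the `growth` term. The gradient-velocity terms
carrying the old weight cancel; those created by the jump of the weight are absorbed by `growth`. -/
lemma weighted_energy_le_pointwise (hα : 0 < α) (hγ : 0 < γ) (hη : η = √(γ / 2))
    (hdesc : ∀ y, f (y - γ • G y) ≤ f y - γ / 2 * ‖G y‖ ^ 2) (hm : ∀ x, m ≤ f x)
    (q : E × E × ℝ) :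
    weight α (q.2.2 + 1) * energy f m (jump γ η G q) + dissipation α γ G q ≤
      weight α q.2.2 * energy f m q - (weight α q.2.2 * energyRate α η G q -
        α * q.2.2 * Real.exp (q.2.2 - 6 / α) * energy f m q) + growth α * energy f m q := by
  have h0 := grad_sq_le hdesc hm q
  have hφ : 0 ≤ energy f m q := le_trans (by positivity) h0
  have h2 := inner_le_energy hγ hη (abs_real_inner_le_norm _ _) h0
  have h3 := neg_abs_le (η * inner ℝ (G q.1) q.2.1)
  have hj := mul_le_mul_of_nonneg_left (energy_jump_le (m := m) hγ hη hdesc q)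
    (zero_le_one.trans (one_le_weight α (q.2.2 + 1)))
  have hk := mul_le_mul_of_nonneg_right (exp_mul_sub_le_growth (h := q.2.2) hα) hφ
  have he : Real.exp (q.2.2 + 1 - 6 / α) = Real.exp 1 * Real.exp (q.2.2 - 6 / α) := by
    rw [← Real.exp_add]; ring_nf
  have hw : weight α (q.2.2 + 1) = weight α q.2.2 +
      (Real.exp 1 - 1) * Real.exp (q.2.2 - 6 / α) := by
    unfold weight; rw [he]; ring
  have h1e : Real.exp 1 - 1 ≤ 1.71829 := by linarith [Real.exp_one_lt_d9]
  have h1e' : 0 ≤ Real.exp 1 - 1 := by linarith [Real.add_one_le_exp (1 : ℝ)]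
  set X := Real.exp (q.2.2 - 6 / α)
  have hX : 0 ≤ X := Real.exp_nonneg _
  -- The constant 3 bounds (e - 1)(1 + 18/25), about 2.96.
  have hcross : (Real.exp 1 - 1) * X * (energy f m q - η * inner ℝ (G q.1) q.2.1) ≤
      X * (3 * energy f m q) := by
    have h4 : energy f m q - η * inner ℝ (G q.1) q.2.1 ≤ 43 / 25 * energy f m q := by linarith
    have h5 : (Real.exp 1 - 1) * (energy f m q - η * inner ℝ (G q.1) q.2.1) ≤
        3 * energy f m q := by nlinarith
    nlinarith
  simp only [dissipation, energyRate]
  rw [hw] at hj ⊢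
  nlinarith

lemma integral_weighted_energy_le (hfG : ∀ x, HasGradientAt f (G x) x) (hG : Continuous G)
    (hα : 0 < α) (hγ : 0 < γ) (hη : η = √(γ / 2))
    (hdesc : ∀ y, f (y - γ • G y) ≤ f y - γ / 2 * ‖G y‖ ^ 2) (hm : ∀ x, m ≤ f x)
    (q : E × E × ℝ) :
    ∫ s, (weight α ((flow α η (Real.exp (-α * s)) q).2.2 + 1) *
        energy f m (jump γ η G (flow α η (Real.exp (-α * s)) q)) +
        dissipation α γ G (flow α η (Real.exp (-α * s)) q)) ∂(expMeasure 1) ≤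
      (1 + 4 * growth α) * (weight α q.2.2 * energy f m q) := by
  have hf : Continuous f := continuous_iff_continuousAt.2 fun x => (hfG x).continuousAt
  have hfl := continuous_flow (α := α) (η := η) q
  have hw := continuous_weight (α := α)
  have hen := continuous_energy (m := m) hf
  have hr := continuous_energyRate (α := α) (η := η) hG
  have hj := continuous_jump (γ := γ) (η := η) hG
  have hdi := continuous_dissipation (α := α) (γ := γ) hG
  have c0 : Continuous fun p : E × E × ℝ => weight α (p.2.2 + 1) * energy f m (jump γ η G p) +
      dissipation α γ G p := by fun_prop
  have c1 : Continuous fun p : E × E × ℝ => weight α p.2.2 * energy f m p := by fun_prop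
  have c2 : Continuous fun p : E × E × ℝ => weight α p.2.2 * energyRate α η G p -
      α * p.2.2 * Real.exp (p.2.2 - 6 / α) * energy f m p := by fun_prop
  have i0 := integrable_comp_exp hα.le (c0.comp hfl)
  have i1 := integrable_comp_exp hα.le (c1.comp hfl)
  have i2 := integrable_comp_exp hα.le (c2.comp hfl)
  have i3 := integrable_comp_exp hα.le (hen.comp hfl)
  obtain ⟨M, hM⟩ := exists_bound_comp_exp hα.le (c1.comp hfl)
  have hd : ∀ s, HasDerivAt (fun s => weight α (flow α η (Real.exp (-α * s)) q).2.2 *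
      energy f m (flow α η (Real.exp (-α * s)) q))
      (weight α (flow α η (Real.exp (-α * s)) q).2.2 *
        energyRate α η G (flow α η (Real.exp (-α * s)) q) -
      α * (flow α η (Real.exp (-α * s)) q).2.2 *
        Real.exp ((flow α η (Real.exp (-α * s)) q).2.2 - 6 / α) *
        energy f m (flow α η (Real.exp (-α * s)) q)) s := by
    intro s
    have he : HasDerivAt (fun s : ℝ => Real.exp (-α * s)) (-α * Real.exp (-α * s)) s := by
      have := ((hasDerivAt_id s).const_mul (-α)).exp
      exact this.congr_deriv (by simp; ring)
    have hwt := (((he.mul_const q.2.2).sub_const (6 / α)).exp).const_add 1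
    have := hwt.mul (hasDerivAt_energy_flow (m := m) (η := η) hfG hα.ne' q s)
    refine this.congr_deriv ?_
    simp only [weight, flow]
    ring
  have h := integral_sub_deriv_expMeasure_one hd hM i1 i2
  simp only [mul_zero, Real.exp_zero, flow_one] at h
  have h1 := integral_energy_flow_le hfG hG hα hγ hη hdesc hm q
  have h0 : 0 ≤ energy f m q := le_trans (by positivity) (grad_sq_le hdesc hm q)
  calc _ ≤ ∫ s, ((weight α (flow α η (Real.exp (-α * s)) q).2.2 *
      energy f m (flow α η (Real.exp (-α * s)) q) -
      (weight α (flow α η (Real.exp (-α * s)) q).2.2 *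
        energyRate α η G (flow α η (Real.exp (-α * s)) q) -
      α * (flow α η (Real.exp (-α * s)) q).2.2 *
        Real.exp ((flow α η (Real.exp (-α * s)) q).2.2 - 6 / α) *
        energy f m (flow α η (Real.exp (-α * s)) q))) +
      growth α * energy f m (flow α η (Real.exp (-α * s)) q)) ∂(expMeasure 1) :=
        integral_mono i0 ((i1.sub i2).add (i3.const_mul _)) fun s =>
          weighted_energy_le_pointwise hα hγ hη hdesc hm _
    _ = weight α q.2.2 * energy f m q +
        growth α * ∫ s, energy f m (flow α η (Real.exp (-α * s)) q) ∂(expMeasure 1) := by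
      rw [← h, ← integral_const_mul]
      exact integral_add (i1.sub i2) (i3.const_mul _)
    _ ≤ weight α q.2.2 * energy f m q + growth α * (4 * (weight α q.2.2 * energy f m q)) := by
      have := growth_nonneg hα.le
      have := one_le_weight α q.2.2
      gcongr
      nlinarith
    _ = _ := by ring

end Analysis

/-! ### Recursive inequalities -/

lemma add_sum_le_of_recursion {a e : ℕ → ℝ} {c : ℝ} (hc : 1 ≤ c) (he : ∀ k, 0 ≤ e k)
    (h : ∀ k, a (k + 1) + e k ≤ c * a k) (n : ℕ) :
    a n + ∑ k ∈ Finset.range n, e k ≤ c ^ n * a 0 := by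
  induction n with
  | zero => simp
  | succ n ih =>
    rw [Finset.sum_range_succ, pow_succ]
    have h1 : 0 ≤ ∑ k ∈ Finset.range n, e k := Finset.sum_nonneg fun k _ => he k
    nlinarith [h n]

lemma sum_le_of_contraction {d b : ℕ → ℝ} {ρ : ℝ} (hρ : 0 ≤ ρ) (hd : ∀ k, 0 ≤ d k)
    (h0 : d 0 = 0) (h : ∀ k, d (k + 1) ≤ ρ * d k + b k) (hb : ∀ k, 0 ≤ b k) (n : ℕ) :
    (1 - ρ) * ∑ k ∈ Finset.range n, d k ≤ ∑ k ∈ Finset.range n, b k := by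
  cases n with
  | zero => simp
  | succ n =>
    have h1 : ∑ k ∈ Finset.range (n + 1), d k ≤
        ρ * ∑ k ∈ Finset.range n, d k + ∑ k ∈ Finset.range n, b k := by
      rw [Finset.sum_range_succ', h0, add_zero, Finset.mul_sum, ← Finset.sum_add_distrib]
      exact Finset.sum_le_sum fun k _ => h k
    have h2 : ∑ k ∈ Finset.range n, d k ≤ ∑ k ∈ Finset.range (n + 1), d k := by
      rw [Finset.sum_range_succ]; linarith [hd n]
    have h3 : ∑ k ∈ Finset.range n, b k ≤ ∑ k ∈ Finset.range (n + 1), b k := by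
      rw [Finset.sum_range_succ]; linarith [hb n]
    nlinarith

/-- Here nα = α^{-6} meets e^{-3/α}. The sixth power of α⁻¹ ≤ 2e^{α⁻¹/2 - 1} produces exactly
e^{3/α}, leaving 256e^{-7}. -/
lemma four_growth_mul_le {α : ℝ} {n : ℕ} (hα : 0 < α) (hn : (n : ℝ) * α ^ 7 = 1) :
    n * (4 * growth α) ≤ 1 / 4 := by
  have h1 : α⁻¹ ≤ 2 * Real.exp (α⁻¹ / 2 - 1) := by
    linarith [Real.add_one_le_exp (α⁻¹ / 2 - 1)]
  have h2 : (α⁻¹) ^ 6 ≤ 64 * Real.exp (3 * α⁻¹ - 6) := by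
    calc (α⁻¹) ^ 6 ≤ (2 * Real.exp (α⁻¹ / 2 - 1)) ^ 6 := by gcongr
      _ = 64 * Real.exp (3 * α⁻¹ - 6) := by
        rw [mul_pow, ← Real.exp_nat_mul]; push_cast; ring_nf
  have h3 : (n : ℝ) * α = (α⁻¹) ^ 6 := by
    field_simp
    linarith
  have h4 : n * (4 * growth α) = 4 * (α⁻¹) ^ 6 * Real.exp (-3 * α⁻¹ - 1) := by
    rw [← h3, growth, mul_left_comm (Real.exp _), ← Real.exp_add]
    ring_nf
  have h5 : Real.exp (3 * α⁻¹ - 6) * Real.exp (-3 * α⁻¹ - 1) = Real.exp (-7) := by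
    rw [← Real.exp_add]; ring_nf
  have h6 : Real.exp (-7) ≤ 1 / 1024 := by
    have he : (1024 : ℝ) ≤ Real.exp 7 := by
      have : Real.exp 7 = Real.exp 1 ^ 7 := by rw [← Real.exp_nat_mul]; norm_num
      rw [this]
      calc (1024 : ℝ) ≤ 2.7 ^ 7 := by norm_num
        _ ≤ _ := by gcongr; linarith [Real.exp_one_gt_d9]
    rw [Real.exp_neg, one_div]
    gcongr
  rw [h4]
  calc 4 * (α⁻¹) ^ 6 * Real.exp (-3 * α⁻¹ - 1)
      ≤ 4 * (64 * Real.exp (3 * α⁻¹ - 6)) * Real.exp (-3 * α⁻¹ - 1) := by gcongr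
    _ = 256 * Real.exp (-7) := by rw [← h5]; ring
    _ ≤ 1 / 4 := by linarith

lemma initial_weight_mul_le {α : ℝ} {n : ℕ} (hα : 0 < α) (hα1 : α ≤ 3 / 4)
    (hn : (n : ℝ) * α ^ 7 = 1) : (1 + 4 * growth α) ^ n * weight α 0 ≤ 3 / 2 := by
  have h1 : (1 + 4 * growth α) ^ n ≤ Real.exp (1 / 4) := by
    calc (1 + 4 * growth α) ^ n ≤ Real.exp (4 * growth α) ^ n := by
          have := growth_nonneg hα.le
          gcongr
          linarith [Real.add_one_le_exp (4 * growth α)]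
      _ = Real.exp (n * (4 * growth α)) := by rw [Real.exp_nat_mul]
      _ ≤ _ := Real.exp_le_exp.2 (four_growth_mul_le hα hn)
  have h2 : Real.exp (1 / 4) ≤ 13 / 10 := by
    have h : Real.exp 1 = Real.exp (1 / 4) ^ 4 := by rw [← Real.exp_nat_mul]; norm_num
    by_contra hc
    push Not at hc
    have : (13 / 10 : ℝ) ^ 4 < Real.exp (1 / 4) ^ 4 := by gcongr
    rw [← h] at this
    norm_num at this
    linarith [Real.exp_one_lt_d9]
  have h3 : weight α 0 ≤ 1 + 1 / 9 := by
    have h : Real.exp (0 - 6 / α) ≤ Real.exp (-8) := by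
      apply Real.exp_le_exp.2
      have : 8 ≤ 6 / α := by rw [le_div_iff₀ hα]; linarith
      linarith
    have h' : Real.exp (-8) ≤ 1 / 9 := by
      rw [Real.exp_neg, one_div]
      gcongr
      linarith [Real.add_one_le_exp (8 : ℝ)]
    unfold weight; linarith
  have := one_le_weight α 0
  calc _ ≤ (13 / 10 : ℝ) * (1 + 1 / 9) := by gcongr; exact h1.trans h2
    _ ≤ _ := by norm_num

/-! ### The chain along a sequence of waiting times -/

section Chain

variable {E : Type*} [NormedAddCommGroup E] [InnerProductSpace ℝ E] [ProperSpace E]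
  [MeasurableSpace E] [BorelSpace E]

/-- The process after `k` jumps. -/
def chain (α γ η : ℝ) (G : E → E) (x₀ : E) (s : ℕ → ℝ) : ℕ → E × E × ℝ
  | 0 => (x₀, 0, 0)
  | k + 1 => jump γ η G (flow α η (Real.exp (-α * s k)) (chain α γ η G x₀ s k))

/-- The process immediately before the jump number `k + 1`. -/
def pre (α γ η : ℝ) (G : E → E) (x₀ : E) (s : ℕ → ℝ) (k : ℕ) : E × E × ℝ :=
  flow α η (Real.exp (-α * s k)) (chain α γ η G x₀ s k)

/-- The `k`-th jump time. -/
def time (s : ℕ → ℝ) (k : ℕ) : ℝ := ∑ i ∈ Finset.range k, s i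

/-- The discounted squared distances of the earlier points to the latest one. -/
def spread (α γ η : ℝ) (G : E → E) (x₀ : E) (s : ℕ → ℝ) (k : ℕ) : ℝ :=
  ∑ i ∈ Finset.range (k + 1), Real.exp (-α * (time s (k + 1) - time s (i + 1))) *
    ‖(pre α γ η G x₀ s i).1 - (pre α γ η G x₀ s k).1‖ ^ 2

variable {α γ η : ℝ} {G : E → E} {x₀ : E}

lemma chain_succ (s : ℕ → ℝ) (k : ℕ) :
    chain α γ η G x₀ s (k + 1) = jump γ η G (pre α γ η G x₀ s k) := rfl

lemma past_chain (k : ℕ) : Past k fun s => chain α γ η G x₀ s k := by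
  induction k with
  | zero => exact fun s s' _ => rfl
  | succ k ih =>
    intro s s' hs
    have h : chain α γ η G x₀ s k = chain α γ η G x₀ s' k :=
      ih s s' fun i hi => hs i (hi.trans k.lt_succ_self)
    simp only [chain]
    rw [h, hs k k.lt_succ_self]

lemma past_pre (k : ℕ) : Past (k + 1) fun s => pre α γ η G x₀ s k := by
  intro s s' hs
  have h : chain α γ η G x₀ s k = chain α γ η G x₀ s' k :=
    past_chain k s s' fun i hi => hs i (hi.trans k.lt_succ_self)
  simp only [pre]
  rw [h, hs k k.lt_succ_self]

lemma pre_update (s : ℕ → ℝ) (k : ℕ) (x : ℝ) : pre α γ η G x₀ (Function.update s k x) k =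
    flow α η (Real.exp (-α * x)) (chain α γ η G x₀ s k) := by
  have h : chain α γ η G x₀ (Function.update s k x) k = chain α γ η G x₀ s k :=
    (past_chain k).update s x
  rw [pre, h, Function.update_self]

lemma tame_flow (hα : 0 ≤ α) (k : ℕ) {Φ : (ℕ → ℝ) → E × E × ℝ} (hΦ : Tame Φ) :
    Tame fun s => flow α η (Real.exp (-α * s k)) (Φ s) := by
  refine (Tame.exp_wait hα k).comp₂ hΦ (G := fun r q => flow α η r q) ?_
  unfold flow
  fun_prop

lemma tame_chain (hα : 0 ≤ α) (hG : Continuous G) (k : ℕ) :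
    Tame fun s => chain α γ η G x₀ s k := by
  induction k with
  | zero => exact Tame.const _
  | succ k ih => exact (tame_flow hα k ih).comp (continuous_jump hG)

lemma tame_pre (hα : 0 ≤ α) (hG : Continuous G) (k : ℕ) :
    Tame fun s => pre α γ η G x₀ s k := tame_flow hα k (tame_chain hα hG k)

lemma chain_count_nonneg (s : ℕ → ℝ) (k : ℕ) : 0 ≤ (chain α γ η G x₀ s k).2.2 := by
  induction k with
  | zero => simp [chain]
  | succ k ih =>
    simp only [chain, jump, flow]
    have := mul_nonneg (Real.exp_nonneg (-α * s k)) ih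
    linarith

lemma pre_count_nonneg (s : ℕ → ℝ) (k : ℕ) : 0 ≤ (pre α γ η G x₀ s k).2.2 :=
  mul_nonneg (Real.exp_nonneg _) (chain_count_nonneg s k)

lemma chain_count (s : ℕ → ℝ) (k : ℕ) : (chain α γ η G x₀ s k).2.2 =
    ∑ i ∈ Finset.range k, Real.exp (-α * (time s k - time s (i + 1))) := by
  induction k with
  | zero => simp [chain]
  | succ k ih =>
    rw [Finset.sum_range_succ, sub_self, mul_zero, Real.exp_zero]
    simp only [chain, jump, flow, ih, Finset.mul_sum, ← Real.exp_add]
    congr 1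
    refine Finset.sum_congr rfl fun i _ => ?_
    rw [time, time, time, Finset.sum_range_succ s k]
    ring_nf

lemma tame_discount (hα : 0 ≤ α) {i k : ℕ} (hik : i ≤ k) :
    Tame fun s => Real.exp (-α * (time s k - time s i)) := by
  refine ⟨by unfold time; fun_prop, 1, fun s hs => ?_⟩
  have h : time s i ≤ time s k :=
    Finset.sum_le_sum_of_subset_of_nonneg (by simpa using hik) fun j _ _ => hs j
  rw [Real.norm_of_nonneg (Real.exp_nonneg _), Real.exp_le_one_iff]
  nlinarith

lemma tame_spread (hα : 0 ≤ α) (hG : Continuous G) (k : ℕ) :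
    Tame fun s => spread α γ η G x₀ s k := by
  refine Tame.sum _ fun i hi => ?_
  refine (tame_discount hα (by simp at hi; omega)).mul ?_
  exact (tame_pre hα hG i).comp₂ (tame_pre hα hG k)
    (G := fun p q : E × E × ℝ => ‖p.1 - q.1‖ ^ 2) (by fun_prop)

lemma past_spread (k : ℕ) : Past (k + 1) fun s => spread α γ η G x₀ s k := by
  intro s s' hs
  simp only [spread]
  refine Finset.sum_congr rfl fun i hi => ?_
  have hi : i < k + 1 := by simpa using hi
  have h : ∀ l ≤ k, pre α γ η G x₀ s l = pre α γ η G x₀ s' l := fun l hl =>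
    past_pre l s s' fun j hj => hs j (by omega)
  rw [h k le_rfl, h i (by omega)]
  have ht : ∀ l ≤ k + 1, time s l = time s' l := fun l hl =>
    Finset.sum_congr rfl fun j hj => hs j ((Finset.mem_range.1 hj).trans_le hl)
  rw [ht _ le_rfl, ht _ hi]

lemma norm_add_sq_le_weighted {c : ℝ} (hc : 0 < c) (a b : E) :
    ‖a + b‖ ^ 2 ≤ (1 + c) * ‖a‖ ^ 2 + (1 + 1 / c) * ‖b‖ ^ 2 := by
  have h1 : ‖a + b‖ ^ 2 ≤ (‖a‖ + ‖b‖) ^ 2 := by gcongr; exact norm_add_le a b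
  have h2 : 2 * (‖a‖ * ‖b‖) ≤ c * ‖a‖ ^ 2 + 1 / c * ‖b‖ ^ 2 := by
    have h := sq_nonneg (c * ‖a‖ - ‖b‖)
    have : c * ‖a‖ ^ 2 + 1 / c * ‖b‖ ^ 2 - 2 * (‖a‖ * ‖b‖) = 1 / c * (c * ‖a‖ - ‖b‖) ^ 2 := by
      field_simp
      ring
    have h3 : 0 ≤ 1 / c * (c * ‖a‖ - ‖b‖) ^ 2 := by positivity
    linarith
  nlinarith

/-- Moving the reference point from one iterate to the next by Young's inequality with parameter
α/2: small enough that the mean discount 1/(1+α) still beats the factor 1 + α/2. -/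
lemma spread_succ_le (hα : 0 < α) (s : ℕ → ℝ) (k : ℕ) :
    spread α γ η G x₀ s (k + 1) ≤ Real.exp (-α * s (k + 1)) *
      ((1 + α / 2) * spread α γ η G x₀ s k + (1 + 2 / α) * ((chain α γ η G x₀ s (k + 1)).2.2 *
        ‖(pre α γ η G x₀ s k).1 - (pre α γ η G x₀ s (k + 1)).1‖ ^ 2)) := by
  rw [spread, Finset.sum_range_succ, sub_self, sub_self, norm_zero]
  rw [chain_count, spread, Finset.sum_mul, Finset.mul_sum, Finset.mul_sum,
    ← Finset.sum_add_distrib, Finset.mul_sum]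
  simp only [ne_eq, OfNat.ofNat_ne_zero, not_false_eq_true, zero_pow, mul_zero, add_zero]
  refine Finset.sum_le_sum fun i _ => ?_
  have h1 : Real.exp (-α * (time s (k + 1 + 1) - time s (i + 1))) =
      Real.exp (-α * s (k + 1)) * Real.exp (-α * (time s (k + 1) - time s (i + 1))) := by
    rw [← Real.exp_add, time, Finset.sum_range_succ, ← time]
    ring_nf
  have h2 := norm_add_sq_le_weighted (c := α / 2) (by positivity)
    ((pre α γ η G x₀ s i).1 - (pre α γ η G x₀ s k).1)
    ((pre α γ η G x₀ s k).1 - (pre α γ η G x₀ s (k + 1)).1)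
  rw [sub_add_sub_cancel, one_div_div] at h2
  rw [h1, mul_assoc]
  refine mul_le_mul_of_nonneg_left ?_ (Real.exp_nonneg _)
  have := mul_le_mul_of_nonneg_left h2 (Real.exp_nonneg (-α * (time s (k + 1) - time s (i + 1))))
  linarith

/-! ### Bounds of the local quantities by the dissipation -/

lemma norm_jump_sq_le (hγ : 0 < γ) (hη : η = √(γ / 2)) (p : E × E × ℝ) :
    ‖(jump γ η G p).2.1‖ ^ 2 ≤ 2 * ‖p.2.1‖ ^ 2 + γ * ‖G p.1‖ ^ 2 := by
  have hη2 : η ^ 2 = γ / 2 := by rw [hη]; exact Real.sq_sqrt (by positivity)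
  have h := norm_add_sq_le_weighted one_pos p.2.1 (-(η • G p.1))
  rw [norm_neg, norm_smul, mul_pow, Real.norm_eq_abs, sq_abs, hη2, ← sub_eq_add_neg] at h
  simp only [jump]
  linarith

lemma mul_norm_jump_sq_le (hα : 0 < α) (hα1 : α ≤ 3 / 4) (hγ : 0 < γ) (hη : η = √(γ / 2))
    (p : E × E × ℝ) : α * ‖(jump γ η G p).2.1‖ ^ 2 ≤ 3 * dissipation α γ G p := by
  have h := mul_le_mul_of_nonneg_left (norm_jump_sq_le (G := G) hγ hη p) hα.le
  have h1 := mul_le_mul_of_nonneg_left (one_le_weight α p.2.2)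
    (mul_nonneg hα.le (sq_nonneg ‖p.2.1‖))
  have h2 := mul_le_mul_of_nonneg_left (one_le_weight α (p.2.2 + 1))
    (mul_nonneg hγ.le (sq_nonneg ‖G p.1‖))
  have h3 := mul_nonneg (sub_nonneg.2 hα1) (mul_nonneg hγ.le (sq_nonneg ‖G p.1‖))
  have h4 := mul_nonneg hα.le (sq_nonneg ‖p.2.1‖)
  unfold dissipation
  nlinarith

/-- The left factor is the bound on the mean squared displacement. The constant is 4γ (from
`norm_jump_sq_le`) times 6/α (h against the weight) times 3/α (weighted squares against the
dissipation). -/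
lemma count_mul_le (hα : 0 < α) (hα1 : α ≤ 3 / 4) (hγ : 0 < γ) (hη : η = √(γ / 2))
    (p : E × E × ℝ) (hp : 0 ≤ p.2.2) :
    (p.2.2 + 1) * (2 * γ ^ 2 * ‖G p.1‖ ^ 2 + 2 * γ * ‖(jump γ η G p).2.1‖ ^ 2) ≤
      72 * γ / α ^ 2 * dissipation α γ G p := by
  have h1 := norm_jump_sq_le (G := G) hγ hη p
  have h2 : α * (p.2.2 + 1) ≤ 6 * weight α p.2.2 := mul_add_one_le_weight hα (by linarith)
  have h3 : weight α p.2.2 ≤ weight α (p.2.2 + 1) := weight_mono (by linarith)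
  have hg := mul_nonneg hγ.le (sq_nonneg ‖G p.1‖)
  have hu := sq_nonneg ‖p.2.1‖
  have h4 : α * (p.2.2 + 1) * (γ * ‖G p.1‖ ^ 2 + ‖p.2.1‖ ^ 2) ≤
      6 * (weight α (p.2.2 + 1) * (γ * ‖G p.1‖ ^ 2) + weight α p.2.2 * ‖p.2.1‖ ^ 2) := by
    nlinarith [mul_le_mul_of_nonneg_right h2 hu, mul_le_mul_of_nonneg_right (h2.trans
      (mul_le_mul_of_nonneg_left h3 (by norm_num))) hg]
  have hw : 0 ≤ weight α (p.2.2 + 1) * (γ * ‖G p.1‖ ^ 2) :=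
    mul_nonneg (zero_le_one.trans (one_le_weight _ _)) hg
  have hw' : 0 ≤ weight α p.2.2 * ‖p.2.1‖ ^ 2 :=
    mul_nonneg (zero_le_one.trans (one_le_weight _ _)) hu
  have h5 : α * (weight α (p.2.2 + 1) * (γ * ‖G p.1‖ ^ 2) + weight α p.2.2 * ‖p.2.1‖ ^ 2) ≤
      3 * dissipation α γ G p := by
    unfold dissipation
    nlinarith
  have h6 : (p.2.2 + 1) * (2 * γ ^ 2 * ‖G p.1‖ ^ 2 + 2 * γ * ‖(jump γ η G p).2.1‖ ^ 2) ≤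
      (p.2.2 + 1) * (4 * γ * (γ * ‖G p.1‖ ^ 2 + ‖p.2.1‖ ^ 2)) := by
    refine mul_le_mul_of_nonneg_left ?_ (by linarith)
    nlinarith [mul_le_mul_of_nonneg_left h1 hγ.le]
  refine h6.trans ?_
  rw [div_mul_eq_mul_div, le_div_iff₀ (by positivity)]
  have h7 := mul_le_mul_of_nonneg_left h4 (mul_nonneg hα.le hγ.le)
  have h8 := mul_le_mul_of_nonneg_left h5 hγ.le
  nlinarith

end Chain

/-! ### Expectations along the chain -/

section Expectation

variable {E : Type*} [NormedAddCommGroup E] [InnerProductSpace ℝ E] [ProperSpace E]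
  [MeasurableSpace E] [BorelSpace E]
  {Ω : Type*} [MeasurableSpace Ω] {μ : Measure Ω} [IsProbabilityMeasure μ] {τ : ℕ → Ω → ℝ}
  {f : E → ℝ} {G : E → E} {α γ η m : ℝ} {x₀ : E}

lemma IsPoissonClock.integral_chain_count (hτ : IsPoissonClock μ τ) (hα : 0 < α)
    (hG : Continuous G) (k : ℕ) :
    ∫ ω, (chain α γ η G x₀ (fun i => τ i ω) k).2.2 ∂μ =
      (1 + α) / α * (1 - (1 / (1 + α)) ^ k) := by
  induction k with
  | zero => simp [chain]
  | succ k ih =>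
    have ht : Tame fun s => (chain α γ η G x₀ s k).2.2 :=
      (tame_chain hα.le hG k).comp (G := fun q : E × E × ℝ => q.2.2) (by fun_prop)
    have hp : Past k fun s => (chain α γ η G x₀ s k).2.2 := fun s s' hs =>
      congrArg (fun q : E × E × ℝ => q.2.2) (past_chain k s s' hs)
    have h := hτ.integral_exp_mul ht hp hα
    simp only [chain, jump, flow]
    rw [integral_add (((Tame.exp_wait hα.le k).mul ht).integrable hτ) (integrable_const _), h, ih]
    simp
    field_simp
    ring

lemma IsPoissonClock.integral_count_le (hτ : IsPoissonClock μ τ) (hα : 0 < α)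
    (hG : Continuous G) (k : ℕ) :
    ∫ ω, (chain α γ η G x₀ (fun i => τ i ω) k).2.2 ∂μ ≤ (1 + α) / α := by
  rw [hτ.integral_chain_count hα hG]
  have h1 : 0 ≤ (1 + α) / α := by positivity
  have h2 : 0 ≤ (1 / (1 + α)) ^ k := by positivity
  nlinarith

/-- The second moment dominates the squared mean, which approaches (1+α)² geometrically; the
transient costs only 2/α in total. -/
lemma IsPoissonClock.le_integral_sum_count_sq (hτ : IsPoissonClock μ τ) (hα : 0 < α)
    (hα1 : α ≤ 3 / 4) (hG : Continuous G) {n : ℕ} (hn : (n : ℝ) * α ^ 7 = 1) :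
    3 / 5 * (1 + α) ^ 2 * n ≤ ∫ ω, ∑ k ∈ Finset.range n,
      (α * (chain α γ η G x₀ (fun i => τ i ω) (k + 1)).2.2) ^ 2 ∂μ := by
  have ht : ∀ k, Tame fun s => α * (chain α γ η G x₀ s k).2.2 := fun k =>
    (tame_chain hα.le hG k).comp (G := fun q : E × E × ℝ => α * q.2.2) (by fun_prop)
  rw [integral_finsetSum _ fun k _ => ((ht (k + 1)).pow 2).integrable hτ]
  set r := 1 / (1 + α) with hr
  have hr0 : 0 ≤ r := by positivity
  have hr1 : r < 1 := by rw [hr, div_lt_one (by linarith)]; linarith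
  have h1 : ∀ k, (1 + α) ^ 2 * (1 - 2 * r ^ (k + 1)) ≤
      ∫ ω, (α * (chain α γ η G x₀ (fun i => τ i ω) (k + 1)).2.2) ^ 2 ∂μ := by
    intro k
    have hi := (ht (k + 1)).integrable hτ
    have hi2 := ((ht (k + 1)).pow 2).integrable hτ
    set c := (1 + α) * (1 - r ^ (k + 1)) with hc
    have hmean : ∫ ω, α * (chain α γ η G x₀ (fun i => τ i ω) (k + 1)).2.2 ∂μ = c := by
      rw [integral_const_mul, hτ.integral_chain_count hα hG, hc, ← hr]
      field_simp
    have h2 : ∫ ω, (2 * c * (α * (chain α γ η G x₀ (fun i => τ i ω) (k + 1)).2.2) - c ^ 2) ∂μ ≤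
        ∫ ω, (α * (chain α γ η G x₀ (fun i => τ i ω) (k + 1)).2.2) ^ 2 ∂μ :=
      integral_mono ((hi.const_mul _).sub (integrable_const _)) hi2 fun ω => by
        nlinarith [sq_nonneg (α * (chain α γ η G x₀ (fun i => τ i ω) (k + 1)).2.2 - c)]
    rw [integral_sub (hi.const_mul _) (integrable_const _), integral_const_mul, hmean] at h2
    simp only [integral_const, probReal_univ, one_smul] at h2
    refine le_trans ?_ h2
    rw [hc]
    nlinarith [sq_nonneg ((1 + α) * r ^ (k + 1))]
  refine le_trans ?_ (Finset.sum_le_sum fun k _ => h1 k)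
  rw [← Finset.mul_sum, Finset.sum_sub_distrib, ← Finset.mul_sum]
  have hgeom : ∑ k ∈ Finset.range n, r ^ (k + 1) ≤ 1 / α := by
    simp_rw [pow_succ]
    rw [← Finset.sum_mul]
    have h3 : ∑ k ∈ Finset.range n, r ^ k ≤ (1 - r)⁻¹ := by
      rw [← tsum_geometric_of_lt_one hr0 hr1]
      exact (summable_geometric_of_lt_one hr0 hr1).sum_le_tsum _ fun k _ => by positivity
    calc _ ≤ (1 - r)⁻¹ * r := by gcongr
      _ = 1 / α := by
        have h4 : 1 - r = α * r := by rw [hr]; field_simp; ring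
        have hr' : 0 < r := by positivity
        rw [h4]
        field_simp
  -- Since 1/α = nα⁶ and 2(3/4)⁶ < 2/5.
  have h5 : 2 * (1 / α) ≤ 2 / 5 * n := by
    have h6 : α ^ 6 ≤ (3 / 4) ^ 6 := by gcongr
    have h7 : 1 / α = n * α ^ 6 := by
      rw [div_eq_iff hα.ne']; linarith
    rw [h7]
    have : (n : ℝ) * α ^ 6 ≤ n * (3 / 4) ^ 6 := by gcongr
    norm_num at this
    have hn0 : (0 : ℝ) ≤ n := n.cast_nonneg
    linarith
  simp only [Finset.sum_const, Finset.card_range, nsmul_eq_mul, mul_one]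
  have h8 : 3 / 5 * (n : ℝ) ≤ n - 2 * ∑ k ∈ Finset.range n, r ^ (k + 1) := by linarith
  have := mul_le_mul_of_nonneg_left h8 (sq_nonneg (1 + α))
  linarith

lemma tame_dissipation (hα : 0 ≤ α) (hG : Continuous G) (k : ℕ) :
    Tame fun s => dissipation α γ G (pre α γ η G x₀ s k) :=
  (tame_pre hα hG k).comp (continuous_dissipation hG)

lemma dissipation_nonneg (hα : 0 ≤ α) (hγ : 0 ≤ γ) (p : E × E × ℝ) :
    0 ≤ dissipation α γ G p := by
  have := one_le_weight α p.2.2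
  have := one_le_weight α (p.2.2 + 1)
  unfold dissipation
  positivity

/-- The mean weighted energy is almost a supermartingale: telescoping leaves the factor (1 +
4·growth)ⁿ·weight(0) ≤ 3/2. -/
lemma IsPoissonClock.sum_integral_dissipation_le (hτ : IsPoissonClock μ τ)
    (hfG : ∀ x, HasGradientAt f (G x) x) (hG : Continuous G)
    (hα : 0 < α) (hα1 : α ≤ 3 / 4) (hγ : 0 < γ) (hη : η = √(γ / 2))
    (hdesc : ∀ y, f (y - γ • G y) ≤ f y - γ / 2 * ‖G y‖ ^ 2) (hm : ∀ x, m ≤ f x)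
    {n : ℕ} (hn : (n : ℝ) * α ^ 7 = 1) :
    ∑ k ∈ Finset.range n, ∫ ω, dissipation α γ G (pre α γ η G x₀ (fun i => τ i ω) k) ∂μ ≤
      3 / 2 * (f x₀ - m) := by
  have hf : Continuous f := continuous_iff_continuousAt.2 fun x => (hfG x).continuousAt
  have hw := continuous_weight (α := α)
  have hen := continuous_energy (m := m) hf
  have hj := continuous_jump (γ := γ) (η := η) hG
  have hdi := continuous_dissipation (α := α) (γ := γ) hG
  let a : (ℕ → ℝ) → ℕ → ℝ := fun s k =>
    weight α (chain α γ η G x₀ s k).2.2 * energy f m (chain α γ η G x₀ s k)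
  have hat : ∀ k, Tame fun s => a s k := fun k => (tame_chain hα.le hG k).comp
    (G := fun q : E × E × ℝ => weight α q.2.2 * energy f m q) (by fun_prop)
  have hdt := tame_dissipation (γ := γ) (η := η) (x₀ := x₀) hα.le hG
  have hrec : ∀ k, ∫ ω, a (fun i => τ i ω) (k + 1) ∂μ +
      ∫ ω, dissipation α γ G (pre α γ η G x₀ (fun i => τ i ω) k) ∂μ ≤
      (1 + 4 * growth α) * ∫ ω, a (fun i => τ i ω) k ∂μ := by
    intro k
    rw [← integral_add ((hat (k + 1)).integrable hτ) ((hdt k).integrable hτ), ← integral_const_mul]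
    refine hτ.integral_le_of_resample (k := k)
      (Φ := fun s => a s (k + 1) + dissipation α γ G (pre α γ η G x₀ s k))
      (B := fun s => (1 + 4 * growth α) * a s k) ((hat (k + 1)).add (hdt k)) ?_
      ((hat k).const_mul _) ?_
    · intro s s' hs
      have h : pre α γ η G x₀ s k = pre α γ η G x₀ s' k := past_pre k s s' hs
      simp only [a, chain_succ, h]
    · intro s _
      simp only [a, chain_succ, pre_update]
      exact integral_weighted_energy_le hfG hG hα hγ hη hdesc hm (chain α γ η G x₀ s k)
  have h := add_sum_le_of_recursion (a := fun k => ∫ ω, a (fun i => τ i ω) k ∂μ)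
    (e := fun k => ∫ ω, dissipation α γ G (pre α γ η G x₀ (fun i => τ i ω) k) ∂μ)
    (c := 1 + 4 * growth α)
    (by linarith [growth_nonneg hα.le])
    (fun k => integral_nonneg fun ω => dissipation_nonneg hα.le hγ.le _) hrec n
  have hpos : 0 ≤ ∫ ω, a (fun i => τ i ω) n ∂μ := by
    refine integral_nonneg fun ω => mul_nonneg (zero_le_one.trans (one_le_weight _ _)) ?_
    exact le_trans (by positivity) (grad_sq_le hdesc hm _)
  have h0 : ∫ ω, a (fun i => τ i ω) 0 ∂μ = weight α 0 * (f x₀ - m) := by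
    simp [a, chain, energy]
  rw [h0, ← mul_assoc] at h
  have h1 := mul_le_mul_of_nonneg_right (initial_weight_mul_le hα hα1 hn) (sub_nonneg.2 (hm x₀))
  linarith

lemma tame_norm_velocity (hα : 0 ≤ α) (hG : Continuous G) (k : ℕ) :
    Tame fun s => ‖(chain α γ η G x₀ s k).2.1‖ :=
  (tame_chain hα hG k).comp (G := fun q : E × E × ℝ => ‖q.2.1‖) (by fun_prop)

lemma IsPoissonClock.sum_integral_velocity_sq_le (hτ : IsPoissonClock μ τ)
    (hfG : ∀ x, HasGradientAt f (G x) x) (hG : Continuous G)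
    (hα : 0 < α) (hα1 : α ≤ 3 / 4) (hγ : 0 < γ) (hη : η = √(γ / 2))
    (hdesc : ∀ y, f (y - γ • G y) ≤ f y - γ / 2 * ‖G y‖ ^ 2) (hm : ∀ x, m ≤ f x)
    {n : ℕ} (hn : (n : ℝ) * α ^ 7 = 1) :
    α * ∑ k ∈ Finset.range n, ∫ ω, ‖(chain α γ η G x₀ (fun i => τ i ω) (k + 1)).2.1‖ ^ 2 ∂μ ≤
      9 / 2 * (f x₀ - m) := by
  have h := hτ.sum_integral_dissipation_le (x₀ := x₀) hfG hG hα hα1 hγ hη hdesc hm hn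
  have h1 : α * ∑ k ∈ Finset.range n,
      ∫ ω, ‖(chain α γ η G x₀ (fun i => τ i ω) (k + 1)).2.1‖ ^ 2 ∂μ ≤
      3 * ∑ k ∈ Finset.range n,
        ∫ ω, dissipation α γ G (pre α γ η G x₀ (fun i => τ i ω) k) ∂μ := by
    rw [Finset.mul_sum, Finset.mul_sum]
    refine Finset.sum_le_sum fun k _ => ?_
    rw [← integral_const_mul, ← integral_const_mul]
    refine integral_mono ((((tame_norm_velocity hα.le hG (k + 1)).pow 2).const_mul α).integrable hτ)
      (((tame_dissipation hα.le hG k).const_mul 3).integrable hτ) fun ω => ?_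
    exact mul_norm_jump_sq_le hα hα1 hγ hη _
  linarith

/-- The mean of the squared displacement between two consecutive points. -/
lemma integral_displacement_le (hα : 0 < α) (hγ : 0 < γ) (hη : η = √(γ / 2)) (g v : E) :
    ∫ x, Real.exp (-α * x) * ‖γ • g - (η / α * (1 - Real.exp (-α * x))) • v‖ ^ 2 ∂(expMeasure 1) ≤
      2 * γ ^ 2 * ‖g‖ ^ 2 + 2 * γ * ‖v‖ ^ 2 := by
  have hη2 : η ^ 2 = γ / 2 := by rw [hη]; exact Real.sq_sqrt (by positivity)
  have hi := integrable_comp_exp hα.le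
    (g := fun r => r * ‖γ • g - (η / α * (1 - r)) • v‖ ^ 2) (by fun_prop)
  have hi2 : Integrable (fun x : ℝ => 2 * γ ^ 2 * ‖g‖ ^ 2 + γ * ‖v‖ ^ 2 * x ^ 2) (expMeasure 1) :=
    (integrable_const _).add (integrable_sq_expMeasure_one.const_mul _)
  calc _ ≤ ∫ x, (2 * γ ^ 2 * ‖g‖ ^ 2 + γ * ‖v‖ ^ 2 * x ^ 2) ∂(expMeasure 1) := by
        refine integral_mono_ae hi hi2 ?_
        filter_upwards [ae_pos_expMeasure_one] with x hx
        set r := Real.exp (-α * x) with hr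
        have hr0 : 0 ≤ r := Real.exp_nonneg _
        have hr1 : r ≤ 1 := by rw [hr, Real.exp_le_one_iff]; nlinarith
        -- This cancels the 1/α in the coefficient; the remaining x² has mean 2.
        have hr2 : 1 - r ≤ α * x := by linarith [Real.add_one_le_exp (-α * x)]
        have h1 := norm_add_sq_le_weighted one_pos (γ • g) (-((η / α * (1 - r)) • v))
        rw [norm_neg, norm_smul, norm_smul, mul_pow, mul_pow, Real.norm_eq_abs, Real.norm_eq_abs,
          sq_abs, sq_abs, ← sub_eq_add_neg, mul_pow, div_pow, hη2] at h1
        have h2 : γ / 2 / α ^ 2 * (1 - r) ^ 2 ≤ γ / 2 * x ^ 2 := by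
          have h3 : (1 - r) ^ 2 ≤ (α * x) ^ 2 := by
            apply pow_le_pow_left₀ (by linarith) hr2
          calc _ ≤ γ / 2 / α ^ 2 * (α * x) ^ 2 := by gcongr
            _ = _ := by field_simp
        have h4 := mul_le_mul_of_nonneg_right h2 (sq_nonneg ‖v‖)
        have h5 : r * ‖γ • g - (η / α * (1 - r)) • v‖ ^ 2 ≤
            1 * ‖γ • g - (η / α * (1 - r)) • v‖ ^ 2 := by gcongr
        linarith
    _ = _ := by
        rw [integral_add (integrable_const _) (integrable_sq_expMeasure_one.const_mul _),
          integral_const_mul (γ * ‖v‖ ^ 2), integral_sq_expMeasure_one]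
        simp
        ring

lemma pre_succ_sub (s : ℕ → ℝ) (k : ℕ) :
    (pre α γ η G x₀ s k).1 - (pre α γ η G x₀ s (k + 1)).1 =
      γ • G (pre α γ η G x₀ s k).1 -
        (η / α * (1 - Real.exp (-α * s (k + 1)))) • (chain α γ η G x₀ s (k + 1)).2.1 := by
  rw [pre.eq_1 α γ η G x₀ s (k + 1)]
  simp only [flow]
  rw [chain_succ]
  simp only [jump]
  abel

lemma tame_displacement (hα : 0 ≤ α) (hG : Continuous G) (k : ℕ) :
    Tame fun s => Real.exp (-α * s (k + 1)) * ((chain α γ η G x₀ s (k + 1)).2.2 *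
      ‖(pre α γ η G x₀ s k).1 - (pre α γ η G x₀ s (k + 1)).1‖ ^ 2) := by
  refine (Tame.exp_wait hα (k + 1)).mul (Tame.mul ?_ ?_)
  · exact (tame_chain hα hG (k + 1)).comp (G := fun q : E × E × ℝ => q.2.2) (by fun_prop)
  · exact (tame_pre hα hG k).comp₂ (tame_pre hα hG (k + 1))
      (G := fun p q : E × E × ℝ => ‖p.1 - q.1‖ ^ 2) (by fun_prop)

/-- Given the first `k + 1` waiting times, the count, the gradient and the velocity are fixed, and
only the next waiting time has to be averaged. -/
lemma IsPoissonClock.integral_displacement_le (hτ : IsPoissonClock μ τ)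
    (hG : Continuous G) (hα : 0 < α) (hα1 : α ≤ 3 / 4) (hγ : 0 < γ) (hη : η = √(γ / 2)) (k : ℕ) :
    ∫ ω, Real.exp (-α * τ (k + 1) ω) * ((chain α γ η G x₀ (fun i => τ i ω) (k + 1)).2.2 *
      ‖(pre α γ η G x₀ (fun i => τ i ω) k).1 - (pre α γ η G x₀ (fun i => τ i ω) (k + 1)).1‖ ^ 2) ∂μ
      ≤ 72 * γ / α ^ 2 * ∫ ω, dissipation α γ G (pre α γ η G x₀ (fun i => τ i ω) k) ∂μ := by
  have ht := tame_displacement (γ := γ) (η := η) (x₀ := x₀) hα.le hG k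
  rw [← integral_const_mul]
  refine hτ.integral_le_of_resample (k := k + 1) ht ?_
    ((tame_dissipation hα.le hG k).const_mul (72 * γ / α ^ 2)) ?_
  · intro s s' hs
    have h1 : pre α γ η G x₀ s k = pre α γ η G x₀ s' k :=
      past_pre k s s' fun i hi => hs i (by omega)
    have h2 : pre α γ η G x₀ s (k + 1) = pre α γ η G x₀ s' (k + 1) := past_pre (k + 1) s s' hs
    simp only [chain_succ, h1, h2, hs (k + 1) (by omega)]
  · intro s _
    have h1 : ∀ x, pre α γ η G x₀ (Function.update s (k + 1) x) k = pre α γ η G x₀ s k :=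
      fun x => (past_pre k).update s x
    simp only [pre_succ_sub]
    simp only [chain_succ, h1, Function.update_self]
    set p := pre α γ η G x₀ s k
    have hp : 0 ≤ p.2.2 := pre_count_nonneg s k
    have h2 := CNA.integral_displacement_le hα hγ hη (G p.1) (jump γ η G p).2.1
    have h3 := count_mul_le (G := G) hα hα1 hγ hη p hp
    refine le_trans ?_ h3
    have h4 : (jump γ η G p).2.2 = p.2.2 + 1 := rfl
    simp_rw [h4, mul_left_comm (Real.exp _), integral_const_mul]
    exact mul_le_mul_of_nonneg_left h2 (by linarith)

lemma spread_nonneg (s : ℕ → ℝ) (k : ℕ) : 0 ≤ spread α γ η G x₀ s k :=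
  Finset.sum_nonneg fun _ _ => by positivity

lemma IsPoissonClock.integral_spread_succ_le (hτ : IsPoissonClock μ τ)
    (hG : Continuous G) (hα : 0 < α) (hα1 : α ≤ 3 / 4) (hγ : 0 < γ) (hη : η = √(γ / 2)) (k : ℕ) :
    ∫ ω, spread α γ η G x₀ (fun i => τ i ω) (k + 1) ∂μ ≤
      (1 + α / 2) / (1 + α) * ∫ ω, spread α γ η G x₀ (fun i => τ i ω) k ∂μ +
      (1 + 2 / α) * (72 * γ / α ^ 2 *
        ∫ ω, dissipation α γ G (pre α γ η G x₀ (fun i => τ i ω) k) ∂μ) := by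
  have hst := tame_spread (γ := γ) (η := η) (x₀ := x₀) hα.le hG
  have h1 := hτ.integral_exp_mul (hst k) (past_spread k) hα
  have h2 := hτ.integral_displacement_le (x₀ := x₀) hG hα hα1 hγ hη k
  have i1 := ((((Tame.exp_wait hα.le (k + 1)).mul (hst k)).const_mul (1 + α / 2)).integrable hτ)
  have i2 := ((tame_displacement (γ := γ) (η := η) (x₀ := x₀) hα.le hG k).const_mul
    (1 + 2 / α)).integrable hτ
  have h3 := integral_mono ((hst (k + 1)).integrable hτ) (i1.add i2) fun ω => by
    have := spread_succ_le (γ := γ) (η := η) (G := G) (x₀ := x₀) hα (fun i => τ i ω) k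
    rw [mul_add, mul_left_comm _ (1 + α / 2), mul_left_comm _ (1 + 2 / α)] at this
    exact this
  have h4 := integral_add i1 i2
  rw [integral_const_mul, integral_const_mul, h1] at h4
  have h5 := mul_le_mul_of_nonneg_left h2 (by positivity : 0 ≤ 1 + 2 / α)
  have h6 : (1 + α / 2) * (1 / (1 + α) * ∫ ω, spread α γ η G x₀ (fun i => τ i ω) k ∂μ) =
      (1 + α / 2) / (1 + α) * ∫ ω, spread α γ η G x₀ (fun i => τ i ω) k ∂μ := by ring
  rw [h6] at h4
  refine h3.trans (h4.le.trans ?_)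
  gcongr

/-- Of the power α^{-4}, two come from `count_mul_le`, one from Young's inequality and one from the
contraction gap α/(2(1+α)). The constant is 216 = 72 · 3/2 · 2. -/
lemma IsPoissonClock.sum_integral_spread_le (hτ : IsPoissonClock μ τ)
    (hfG : ∀ x, HasGradientAt f (G x) x) (hG : Continuous G)
    (hα : 0 < α) (hα1 : α ≤ 3 / 4) (hγ : 0 < γ) (hη : η = √(γ / 2))
    (hdesc : ∀ y, f (y - γ • G y) ≤ f y - γ / 2 * ‖G y‖ ^ 2) (hm : ∀ x, m ≤ f x)
    {n : ℕ} (hn : (n : ℝ) * α ^ 7 = 1) :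
    ∑ k ∈ Finset.range n, ∫ ω, spread α γ η G x₀ (fun i => τ i ω) k ∂μ ≤
      216 * (1 + α) * (α + 2) * γ / α ^ 4 * (f x₀ - m) := by
  have hb : ∀ k, 0 ≤ (1 + 2 / α) * (72 * γ / α ^ 2 *
      ∫ ω, dissipation α γ G (pre α γ η G x₀ (fun i => τ i ω) k) ∂μ) := fun k => by
    have : 0 ≤ ∫ ω, dissipation α γ G (pre α γ η G x₀ (fun i => τ i ω) k) ∂μ :=
      integral_nonneg fun ω => dissipation_nonneg hα.le hγ.le _
    positivity
  have h0 : ∫ ω, spread α γ η G x₀ (fun i => τ i ω) 0 ∂μ = 0 := by simp [spread]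
  have h := sum_le_of_contraction (d := fun k => ∫ ω, spread α γ η G x₀ (fun i => τ i ω) k ∂μ)
    (ρ := (1 + α / 2) / (1 + α)) (by positivity)
    (fun k => integral_nonneg fun ω => spread_nonneg _ k) h0
    (hτ.integral_spread_succ_le hG hα hα1 hγ hη) hb n
  have hdis := hτ.sum_integral_dissipation_le (x₀ := x₀) hfG hG hα hα1 hγ hη hdesc hm hn
  rw [← Finset.mul_sum, ← Finset.mul_sum] at h
  have hbsum := mul_le_mul_of_nonneg_left (mul_le_mul_of_nonneg_left hdis
    (by positivity : 0 ≤ 72 * γ / α ^ 2)) (by positivity : 0 ≤ 1 + 2 / α)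
  have hρ : 1 - (1 + α / 2) / (1 + α) = α / (2 * (1 + α)) := by field_simp; ring
  rw [hρ] at h
  have h4 := mul_le_mul_of_nonneg_left (h.trans hbsum) (by positivity : 0 ≤ 2 * (1 + α) / α)
  have h5 : 2 * (1 + α) / α * (α / (2 * (1 + α)) *
      ∑ k ∈ Finset.range n, ∫ ω, spread α γ η G x₀ (fun i => τ i ω) k ∂μ) =
      ∑ k ∈ Finset.range n, ∫ ω, spread α γ η G x₀ (fun i => τ i ω) k ∂μ := by
    field_simp
  rw [h5] at h4
  refine h4.trans (le_of_eq ?_)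
  field_simp
  ring

end Expectation

lemma sum_Icc_one_eq_sum_range {M : Type*} [AddCommMonoid M] (F : ℕ → M) (k : ℕ) :
    ∑ j ∈ Finset.Icc 1 k, F j = ∑ i ∈ Finset.range k, F (i + 1) := by
  induction k with
  | zero => simp
  | succ k ih => rw [Finset.sum_Icc_succ_top (by omega), ih, Finset.sum_range_succ]

/-! ### The jump measure -/

lemma restrict_jumpMeasure {t : ℕ → ℝ} (ht : StrictMono t) (ht0 : t 0 = 0) (k : ℕ) :
    (jumpMeasure t).restrict (Icc 0 (t k)) =
      ∑ i ∈ Finset.range k, Measure.dirac (t (i + 1)) := by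
  have h1 : ∀ i, (Measure.dirac (t (i + 1))).restrict (Icc 0 (t k)) =
      if i ∈ Finset.range k then Measure.dirac (t (i + 1)) else 0 := by
    classical
    intro i
    rw [restrict_dirac' measurableSet_Icc]
    have h2 : t (i + 1) ∈ Icc 0 (t k) ↔ i ∈ Finset.range k := by
      rw [mem_Icc, ht.le_iff_le, Finset.mem_range, ← ht0, ht.le_iff_le]
      omega
    simp only [h2]
  ext A hA
  rw [jumpMeasure, Measure.restrict_sum _ measurableSet_Icc, Measure.sum_apply _ hA,
    Measure.finsetSum_apply]
  simp_rw [h1]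
  rw [tsum_eq_sum (s := Finset.range k) fun i hi => by simp [hi]]
  exact Finset.sum_congr rfl fun i hi => by simp [hi]

lemma setIntegral_jumpMeasure {t : ℕ → ℝ} (ht : StrictMono t) (ht0 : t 0 = 0) (k : ℕ)
    (F : ℝ → ℝ) :
    ∫ u in Icc 0 (t k), F u ∂(jumpMeasure t) = ∑ i ∈ Finset.range k, F (t (i + 1)) := by
  rw [restrict_jumpMeasure ht ht0, integral_finsetSum_measure]
  · simp
  · exact fun i _ => integrable_dirac (by simp)

/-- The closed inner interval contains the atom at its right end, so the jump at `t (k + 1)` counts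
itself. -/
lemma delta_eq {α : ℝ} {t : ℕ → ℝ} (ht : StrictMono t) (ht0 : t 0 = 0) (n : ℕ) :
    delta α t n = ∑ k ∈ Finset.range n, (α * H1 α t (k + 1)) ^ 2 := by
  rw [delta, setIntegral_jumpMeasure ht ht0]
  refine Finset.sum_congr rfl fun k _ => ?_
  rw [setIntegral_jumpMeasure ht ht0, H1, sum_Icc_one_eq_sum_range, Finset.mul_sum]
  congr 1
  refine Finset.sum_congr rfl fun i _ => ?_
  ring_nf

/-! ### The iterates as a chain, and the gradient at an averaged point -/

section Path

variable {E : Type*} [NormedAddCommGroup E] [InnerProductSpace ℝ E] [ProperSpace E]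
  [MeasurableSpace E] [BorelSpace E] {G : E → E} {α γ η : ℝ} {x₀ : E}

lemma H1_time (s : ℕ → ℝ) (k : ℕ) : H1 α (time s) k = (chain α γ η G x₀ s k).2.2 := by
  rw [H1, sum_Icc_one_eq_sum_range, chain_count]

lemma strictMono_time {s : ℕ → ℝ} (hs : ∀ i, 0 < s i) : StrictMono (time s) :=
  strictMono_nat_of_lt_succ fun k => by
    rw [time, time, Finset.sum_range_succ]; linarith [hs k]

lemma time_zero (s : ℕ → ℝ) : time s 0 = 0 := by simp [time]

lemma time_succ_sub (s : ℕ → ℝ) (k : ℕ) : time s (k + 1) - time s k = s k := by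
  rw [time, time, Finset.sum_range_succ]; ring

/-- The discrete updates are the exact solution of the linear flow, written in terms of y instead of
x. Recovering v from y - z requires the nonzero denominator. -/
lemma xz_eq_chain {p : Params} (hα : p.η + p.η' = α) (hα0 : α ≠ 0) (hγ : p.γ = γ) (hη : p.η = η)
    (hγ' : p.γ' = γ + η) {s : ℕ → ℝ} (hs : ∀ i, p.η' + p.η * Real.exp (-α * s i) ≠ 0) (k : ℕ) :
    xz p G x₀ (time s) k = ((chain α γ η G x₀ s k).1,
      (chain α γ η G x₀ s k).1 + (chain α γ η G x₀ s k).2.1) ∧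
    yt p G x₀ (time s) k = (pre α γ η G x₀ s k).1 := by
  have key : ∀ k, xz p G x₀ (time s) k = ((chain α γ η G x₀ s k).1,
      (chain α γ η G x₀ s k).1 + (chain α γ η G x₀ s k).2.1) →
      yt p G x₀ (time s) k = (pre α γ η G x₀ s k).1 := by
    intro k h
    rw [yt, h, time_succ_sub, yStep, hα, hη]
    simp only [pre, flow, add_sub_cancel_left]
    abel
  suffices h : xz p G x₀ (time s) k = ((chain α γ η G x₀ s k).1,
      (chain α γ η G x₀ s k).1 + (chain α γ η G x₀ s k).2.1) from ⟨h, key k h⟩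
  induction k with
  | zero => simp [xz, chain]
  | succ k ih =>
    have hy := key k ih
    have hxz : xz p G x₀ (time s) (k + 1) =
        (xStep p (yt p G x₀ (time s) k) (G (yt p G x₀ (time s) k)),
         zStep p (time s (k + 1) - time s k) (xz p G x₀ (time s) k).2 (yt p G x₀ (time s) k)
          (G (yt p G x₀ (time s) k))) := rfl
    rw [hxz, hy, ih, time_succ_sub, xStep, zStep, hα, hγ, hγ', hη, chain_succ]
    have hsk := hs k
    rw [hη] at hsk
    have hη' : p.η' = α - η := by rw [← hα, hη]; ring
    rw [hη'] at hsk ⊢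
    simp only [jump, Prod.mk.injEq, true_and]
    generalize hg : G (pre α γ η G x₀ s k).1 = g
    simp only [pre, flow]
    generalize Real.exp (-α * s k) = r at hsk
    generalize (chain α γ η G x₀ s k) = c
    -- The last factor is -(α - η + ηr)/α, so the denominator cancels and z moves to y + rv.
    have hcoef : (α - η) * ((1 - r) / (α - η + η * r)) * (η / α * (1 - r) - 1) =
        η / α * (1 - r) + r - 1 := by
      field_simp
      ring
    have h1 : c.1 + (η / α * (1 - r)) • c.2.1 - (c.1 + c.2.1) =
        (η / α * (1 - r) - 1) • c.2.1 := by
      rw [sub_smul, one_smul]; abel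
    rw [h1, smul_smul, hcoef]
    module

/-- The velocity is the discounted sum of the gradients. -/
lemma chain_velocity (s : ℕ → ℝ) (k : ℕ) : (chain α γ η G x₀ s k).2.1 =
    -(η • ∑ i ∈ Finset.range k, Real.exp (-α * (time s k - time s (i + 1))) •
      G (pre α γ η G x₀ s i).1) := by
  induction k with
  | zero => simp [chain]
  | succ k ih =>
    rw [Finset.sum_range_succ, sub_self, mul_zero, Real.exp_zero, one_smul, chain_succ]
    have h : ∀ i, Real.exp (-α * (time s (k + 1) - time s (i + 1))) =
        Real.exp (-α * s k) * Real.exp (-α * (time s k - time s (i + 1))) := by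
      intro i
      rw [← Real.exp_add, ← time_succ_sub s k]
      ring_nf
    simp_rw [h, mul_smul, ← Finset.smul_sum]
    have h2 : (pre α γ η G x₀ s k).2.1 = Real.exp (-α * s k) • (chain α γ η G x₀ s k).2.1 := rfl
    simp only [jump]
    rw [h2, ih, smul_add, neg_add, smul_neg, smul_comm, sub_eq_add_neg]

lemma norm_taylor_le {G' : E → E →L[ℝ] E} (hG' : ∀ x, HasFDerivAt G (G' x) x) {L₂ : ℝ}
    (hL₂ : 0 ≤ L₂) (hlip : ∀ x y, ‖G' x - G' y‖ ≤ L₂ * ‖x - y‖) (x y : E) :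
    ‖G y - G x - G' x (y - x)‖ ≤ L₂ * ‖y - x‖ ^ 2 := by
  have h := (convex_segment x y).norm_image_sub_le_of_norm_hasFDerivWithin_le' (f := G) (f' := G')
    (φ := G' x) (C := L₂ * ‖y - x‖) (fun z _ => (hG' z).hasFDerivWithinAt) (fun z hz => ?_)
    (left_mem_segment ℝ x y) (right_mem_segment ℝ x y)
  · rw [pow_two, ← mul_assoc]; exact h
  · refine (hlip z x).trans ?_
    gcongr
    obtain ⟨a, b, ha, hb, hab, rfl⟩ := hz
    have : a • x + b • y - x = b • (y - x) := by
      rw [smul_sub]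
      have : a = 1 - b := by linarith
      rw [this, sub_smul, one_smul]
      abel
    rw [this, norm_smul, Real.norm_of_nonneg hb]
    have hb1 : b ≤ 1 := by linarith
    nlinarith [norm_nonneg (y - x)]

/-- Averaging points and averaging gradients agree up to the weighted variance of the points. -/
lemma sum_mul_norm_average_le {G' : E → E →L[ℝ] E} (hG' : ∀ x, HasFDerivAt G (G' x) x) {L₂ : ℝ}
    (hL₂ : 0 ≤ L₂) (hlip : ∀ x y, ‖G' x - G' y‖ ≤ L₂ * ‖x - y‖) {ι : Type*} (S : Finset ι)
    {w : ι → ℝ} (hw : ∀ i ∈ S, 0 ≤ w i) (Y : ι → E) {z : E}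
    (hz : (∑ i ∈ S, w i) • z = ∑ i ∈ S, w i • Y i) (c : E) :
    (∑ i ∈ S, w i) * ‖G z‖ ≤ ‖∑ i ∈ S, w i • G (Y i)‖ + L₂ * ∑ i ∈ S, w i * ‖Y i - c‖ ^ 2 := by
  -- As z is the barycentre, the linear Taylor terms sum to zero and the variance about z is the
  -- smallest.
  have hzero : ∑ i ∈ S, w i • (Y i - z) = 0 := by
    simp_rw [smul_sub]
    rw [Finset.sum_sub_distrib, ← Finset.sum_smul, hz, sub_self]
  have hvar : ∑ i ∈ S, w i * ‖Y i - z‖ ^ 2 ≤ ∑ i ∈ S, w i * ‖Y i - c‖ ^ 2 := by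
    have h1 : ∀ i, w i * ‖Y i - c‖ ^ 2 = w i * ‖Y i - z‖ ^ 2 +
        2 * inner ℝ (w i • (Y i - z)) (z - c) + w i * ‖z - c‖ ^ 2 := by
      intro i
      rw [← sub_add_sub_cancel (Y i) z c, norm_add_sq_real, real_inner_smul_left]
      ring
    simp_rw [h1]
    rw [Finset.sum_add_distrib, Finset.sum_add_distrib, ← Finset.mul_sum, ← sum_inner, hzero,
      inner_zero_left]
    have : 0 ≤ ∑ i ∈ S, w i * ‖z - c‖ ^ 2 :=
      Finset.sum_nonneg fun i hi => mul_nonneg (hw i hi) (sq_nonneg _)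
    linarith
  have herr : (∑ i ∈ S, w i) • G z = ∑ i ∈ S, w i • G (Y i) -
      ∑ i ∈ S, w i • (G (Y i) - G z - G' z (Y i - z)) := by
    have h2 : ∑ i ∈ S, w i • G' z (Y i - z) = 0 := by
      simp_rw [← map_smul]
      rw [← map_sum, hzero, map_zero]
    simp_rw [smul_sub (w _)]
    rw [Finset.sum_sub_distrib, Finset.sum_sub_distrib, h2, ← Finset.sum_smul]
    abel
  have hnorm : (∑ i ∈ S, w i) * ‖G z‖ = ‖(∑ i ∈ S, w i) • G z‖ := by
    rw [norm_smul, Real.norm_of_nonneg (Finset.sum_nonneg hw)]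
  rw [hnorm, herr]
  refine (norm_sub_le _ _).trans ?_
  gcongr
  refine (norm_sum_le _ _).trans ?_
  calc _ ≤ ∑ i ∈ S, L₂ * (w i * ‖Y i - z‖ ^ 2) := by
        refine Finset.sum_le_sum fun i hi => ?_
        rw [norm_smul, Real.norm_of_nonneg (hw i hi), mul_left_comm]
        exact mul_le_mul_of_nonneg_left (norm_taylor_le hG' hL₂ hlip z (Y i)) (hw i hi)
    _ ≤ _ := by rw [← Finset.mul_sum]; gcongr

/-- The weights λ are the discounts e^{-α(t_{k+1} - t_{i+1})} divided by their sum h, and the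
discounted gradient sum is -v/η. -/
lemma count_mul_norm_grad_average_le {G' : E → E →L[ℝ] E} (hG' : ∀ x, HasFDerivAt G (G' x) x)
    {L₂ : ℝ} (hL₂ : 0 ≤ L₂) (hlip : ∀ x y, ‖G' x - G' y‖ ≤ L₂ * ‖x - y‖) (hη : 0 < η)
    (s : ℕ → ℝ) (k : ℕ) :
    (chain α γ η G x₀ s (k + 1)).2.2 *
        ‖G (average α (time s) (fun i => (pre α γ η G x₀ s i).1) (k + 1))‖ ≤
      ‖(chain α γ η G x₀ s (k + 1)).2.1‖ / η + L₂ * spread α γ η G x₀ s k := by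
  have hpos : 0 < ∑ i ∈ Finset.range (k + 1),
      Real.exp (-α * (time s (k + 1) - time s (i + 1))) :=
    Finset.sum_pos (fun i _ => Real.exp_pos _) ⟨0, by simp⟩
  have h := sum_mul_norm_average_le hG' hL₂ hlip (Finset.range (k + 1))
    (w := fun i => Real.exp (-α * (time s (k + 1) - time s (i + 1))))
    (fun i _ => Real.exp_nonneg _) (fun i => (pre α γ η G x₀ s i).1)
    (z := average α (time s) (fun i => (pre α γ η G x₀ s i).1) (k + 1)) ?_
    (pre α γ η G x₀ s k).1
  · rw [chain_count, spread]
    refine h.trans (le_of_eq ?_)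
    congr 1
    rw [chain_velocity, norm_neg, norm_smul, Real.norm_of_nonneg hη.le]
    field_simp
  · rw [average, sum_Icc_one_eq_sum_range, Finset.smul_sum]
    refine Finset.sum_congr rfl fun i _ => ?_
    rw [smul_smul, lam, sum_Icc_one_eq_sum_range]
    congr 1
    have h1 : ∀ i, Real.exp (-α * (time s (k + 1) - time s (i + 1))) =
        Real.exp (-α * time s (k + 1)) * Real.exp (α * time s (i + 1)) := by
      intro i
      rw [← Real.exp_add]; ring_nf
    simp_rw [h1, ← Finset.mul_sum]
    have : 0 < ∑ i ∈ Finset.range (k + 1), Real.exp (α * time s (i + 1)) :=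
      Finset.sum_pos (fun i _ => Real.exp_pos _) ⟨0, by simp⟩
    field_simp

end Path

/-! ### Programs -/

section Program

variable {E β β' : Type*}

lemma GradProg.result_bind (G : E → E) (m : GradProg E β) (h : β → GradProg E β') :
    (m.bind h).result G = (h (m.result G)).result G := by
  induction m with
  | ret b => rfl
  | query x next ih => exact ih (G x)

lemma GradProg.evals_bind (G : E → E) (m : GradProg E β) (h : β → GradProg E β') :
    (m.bind h).evals G = m.evals G + (h (m.result G)).evals G := by
  induction m with
  | ret b => simp [bind, evals, result]
  | query x next ih =>
    simp only [bind, evals, result, ih]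
    omega

variable [NormedAddCommGroup E] [NormedSpace ℝ E]

lemma evals_iterations (p : Params) (G : E → E) (x₀ : E) (t : ℕ → ℝ) (k : ℕ) :
    (iterations p x₀ t k).evals G = k := by
  induction k with
  | zero => rfl
  | succ k ih => rw [iterations, GradProg.evals_bind, ih]; rfl

lemma evals_bestPoint (G : E → E) (a : ℕ → E) (m : ℕ) : (bestPoint a m).evals G = m + 1 := by
  induction m with
  | zero => rfl
  | succ m ih => rw [bestPoint, GradProg.evals_bind, ih]; rfl

lemma evals_program (p : Params) (α : ℝ) (G : E → E) (x₀ : E) (t : ℕ → ℝ) {n : ℕ} (hn : 1 ≤ n) :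
    (program p α x₀ t n).evals G = 2 * n := by
  rw [program, GradProg.evals_bind, evals_iterations, GradProg.evals_bind, evals_bestPoint]
  simp only [GradProg.evals]
  omega

lemma result_iterations (p : Params) (G : E → E) (x₀ : E) (t : ℕ → ℝ) (k : ℕ) :
    ((iterations p x₀ t k).result G).1 = (xz p G x₀ t k).1 ∧
    ((iterations p x₀ t k).result G).2.1 = (xz p G x₀ t k).2 ∧
    ∀ i < k, ((iterations p x₀ t k).result G).2.2 i = yt p G x₀ t i := by
  induction k with
  | zero => exact ⟨rfl, rfl, fun i hi => by omega⟩
  | succ k ih =>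
    obtain ⟨h1, h2, h3⟩ := ih
    rw [iterations, GradProg.result_bind]
    simp only [GradProg.result, h1, h2]
    refine ⟨rfl, rfl, fun i hi => ?_⟩
    rcases Nat.lt_succ_iff_lt_or_eq.1 hi with h | h
    · rw [Function.update_of_ne h.ne, h3 i h]
    · rw [h, Function.update_self, yt]

lemma result_bestPoint (G : E → E) (a : ℕ → E) (m : ℕ) :
    ((bestPoint a m).result G).2 = ‖G ((bestPoint a m).result G).1‖ ∧
    (∃ k ∈ Icc 1 (m + 1), ((bestPoint a m).result G).1 = a k) ∧
    ∀ k ∈ Icc 1 (m + 1), ((bestPoint a m).result G).2 ≤ ‖G (a k)‖ := by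
  induction m with
  | zero =>
    refine ⟨rfl, ⟨1, by simp, rfl⟩, fun k hk => ?_⟩
    have : k = 1 := by simpa using hk
    rw [this]
    exact le_rfl
  | succ m ih =>
    obtain ⟨h1, ⟨k₀, hk₀, h2⟩, h3⟩ := ih
    have hlast : m + 2 ∈ Icc 1 (m + 1 + 1) := by simp
    rw [bestPoint, GradProg.result_bind]
    simp only [GradProg.result]
    split_ifs with hlt
    · refine ⟨rfl, ⟨m + 2, hlast, rfl⟩, fun k hk => ?_⟩
      rcases Nat.lt_or_ge k (m + 2) with h | h
      · exact hlt.le.trans (h3 k ⟨hk.1, by omega⟩)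
      · have : k = m + 2 := le_antisymm hk.2 h
        rw [this]
    · refine ⟨h1, ⟨k₀, ⟨hk₀.1, hk₀.2.trans (by omega)⟩, h2⟩, fun k hk => ?_⟩
      rcases Nat.lt_or_ge k (m + 2) with h | h
      · exact h3 k ⟨hk.1, by omega⟩
      · have : k = m + 2 := le_antisymm hk.2 h
        rw [this]
        exact not_lt.1 hlt

lemma average_congr {α : ℝ} {t : ℕ → ℝ} {y y' : ℕ → E} {k : ℕ} (h : ∀ i < k, y i = y' i) :
    average α t y k = average α t y' k := by
  rw [average, average, sum_Icc_one_eq_sum_range, sum_Icc_one_eq_sum_range]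
  exact Finset.sum_congr rfl fun i hi => by rw [Nat.add_sub_cancel, h i (Finset.mem_range.1 hi)]

/-- The method returns a point whose gradient norm is the minimum along the averaged iterates. -/
lemma norm_grad_result_program (p : Params) (α : ℝ) (G : E → E) (x₀ : E) (t : ℕ → ℝ) {n : ℕ}
    (hn : 1 ≤ n) : ‖G ((program p α x₀ t n).result G)‖ =
      ⨅ k : Icc 1 n, ‖G (xbar p α G x₀ t k)‖ := by
  rw [program, GradProg.result_bind, GradProg.result_bind]
  simp only [GradProg.result]
  set a := average α t ((iterations p x₀ t n).result G).2.2 with ha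
  have hak : ∀ k ∈ Icc 1 n, a k = xbar p α G x₀ t k := fun k hk =>
    average_congr fun i hi => (result_iterations p G x₀ t n).2.2 i (hi.trans_le hk.2)
  obtain ⟨h1, ⟨k₀, hk₀, h2⟩, h3⟩ := result_bestPoint G a (n - 1)
  rw [Nat.sub_add_cancel hn] at hk₀ h3
  have : Nonempty (Icc 1 n) := ⟨⟨k₀, hk₀⟩⟩
  refine le_antisymm (le_ciInf fun k => ?_) ?_
  · rw [← h1, ← hak k k.2]
    exact h3 k k.2
  · rw [h2, hak k₀ hk₀]
    exact ciInf_le (f := fun k : Icc 1 n => ‖G (xbar p α G x₀ t k)‖)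
      ⟨0, by rintro _ ⟨k, rfl⟩; exact norm_nonneg _⟩ ⟨k₀, hk₀⟩

end Program

/-! ### The rate -/

lemma rate_pos {n : ℕ} (hn : 8 ≤ n) : 0 < rate n :=
  Real.rpow_pos_of_pos (by exact_mod_cast (by omega : 0 < n)) _

lemma mul_rate_pow {n : ℕ} (hn : 8 ≤ n) : (n : ℝ) * rate n ^ 7 = 1 := by
  have h0 : (0 : ℝ) < n := by exact_mod_cast (by omega : 0 < n)
  rw [rate, ← Real.rpow_natCast, ← Real.rpow_mul h0.le]
  norm_num
  rw [Real.rpow_neg_one, mul_inv_cancel₀ h0.ne']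

/-- From 8(3/4)⁷ > 1; this is the origin of the threshold 8, as 7(3/4)⁷ < 1. -/
lemma rate_le {n : ℕ} (hn : 8 ≤ n) : rate n ≤ 3 / 4 := by
  have h := mul_rate_pow hn
  have h8 : (8 : ℝ) ≤ n := by exact_mod_cast hn
  by_contra hc
  push Not at hc
  have h1 : (3 / 4 : ℝ) ^ 7 < rate n ^ 7 := by gcongr
  have h2 : (8 : ℝ) * (3 / 4) ^ 7 < n * rate n ^ 7 :=
    mul_lt_mul' h8 h1 (by positivity) (by positivity)
  rw [h] at h2
  norm_num at h2

lemma rate_pow_four (n : ℕ) : rate n ^ 4 = (n : ℝ) ^ (-(4 / 7) : ℝ) := by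
  rw [rate, ← Real.rpow_natCast, ← Real.rpow_mul n.cast_nonneg]
  norm_num

/-- Turns Young's inequality with a free ε into Cauchy-Schwarz; the optimal ε is √(V/D), and ε = X/D
settles V = 0 by contradiction. -/
lemma le_sqrt_mul_of_forall {X D V : ℝ} (hD : 0 < D) (hV : 0 ≤ V)
    (h : ∀ ε > 0, X ≤ ε / 2 * D + 1 / (2 * ε) * V) : X ≤ √(D * V) := by
  rcases hV.eq_or_lt with rfl | hV
  · rw [mul_zero, Real.sqrt_zero]
    by_contra hc
    push Not at hc
    have h1 := h (X / D) (by positivity)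
    have h2 : X / D / 2 * D = X / 2 := by field_simp
    rw [h2, mul_zero, add_zero] at h1
    linarith
  · have h1 := h (√(V / D)) (by positivity)
    refine h1.trans (le_of_eq ?_)
    rw [Real.sqrt_div hV.le, Real.sqrt_mul hD.le]
    have hd : 0 < √D := Real.sqrt_pos.2 hD
    have hv : 0 < √V := Real.sqrt_pos.2 hV
    have hd2 : D = √D ^ 2 := (Real.sq_sqrt hD.le).symm
    have hv2 : V = √V ^ 2 := (Real.sq_sqrt hV.le).symm
    generalize √D = d at *
    generalize √V = v at *
    subst hd2 hv2
    field_simp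
    norm_num

/-! ### The weighted bound on the smallest gradient -/

section Main

variable {E : Type*} [NormedAddCommGroup E] [InnerProductSpace ℝ E] [ProperSpace E]
  [MeasurableSpace E] [BorelSpace E]
  {Ω : Type*} [MeasurableSpace Ω] {μ : Measure Ω} [IsProbabilityMeasure μ] {τ : ℕ → Ω → ℝ}
  {f : E → ℝ} {G : E → E} {α γ η m : ℝ} {x₀ : E}

/-- The averaged points of the chain. -/
def chainAverage (α γ η : ℝ) (G : E → E) (x₀ : E) (s : ℕ → ℝ) (k : ℕ) : E :=
  average α (time s) (fun i => (pre α γ η G x₀ s i).1) k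

lemma measurable_chainAverage (hα : 0 ≤ α) (hG : Continuous G) (k : ℕ) :
    Measurable fun s => chainAverage α γ η G x₀ s k := by
  unfold chainAverage average
  refine Finset.measurable_sum _ fun i _ => ?_
  have h1 : Measurable fun s : ℕ → ℝ => lam α (time s) i k := by
    unfold lam time; fun_prop
  have h2 : Measurable fun s => (pre α γ η G x₀ s (i - 1)).1 :=
    measurable_fst.comp (tame_pre hα hG (i - 1)).1
  exact h1.smul h2

/-- The sum of squares that `delta` integrates. -/
def countSq (α γ η : ℝ) (G : E → E) (x₀ : E) (n : ℕ) (s : ℕ → ℝ) : ℝ :=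
  ∑ k ∈ Finset.range n, (α * (chain α γ η G x₀ s (k + 1)).2.2) ^ 2

lemma tame_scaledCount (hα : 0 ≤ α) (hG : Continuous G) (k : ℕ) :
    Tame fun s => α * (chain α γ η G x₀ s k).2.2 :=
  (tame_chain hα hG k).comp (G := fun q : E × E × ℝ => α * q.2.2) (by fun_prop)

lemma tame_countSq (hα : 0 ≤ α) (hG : Continuous G) (n : ℕ) :
    Tame (countSq α γ η G x₀ n) :=
  Tame.sum _ fun k _ => (tame_scaledCount hα hG (k + 1)).pow 2

lemma tame_sum_count_mul_velocity (hα : 0 ≤ α) (hG : Continuous G) (n : ℕ) :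
    Tame fun s => ∑ k ∈ Finset.range n, α * (chain α γ η G x₀ s (k + 1)).2.2 *
      ‖(chain α γ η G x₀ s (k + 1)).2.1‖ :=
  Tame.sum _ fun k _ => (tame_scaledCount hα hG (k + 1)).mul (tame_norm_velocity hα hG (k + 1))

/-- The integrand of the upper bound. -/
def majorant (α γ η : ℝ) (G : E → E) (x₀ : E) (B : ℝ) (n : ℕ) (s : ℕ → ℝ) : ℝ :=
  α / η * ∑ k ∈ Finset.range n, α * (chain α γ η G x₀ s (k + 1)).2.2 *
      ‖(chain α γ η G x₀ s (k + 1)).2.1‖ +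
    B * ∑ k ∈ Finset.range n, spread α γ η G x₀ s k

lemma tame_majorant (hα : 0 ≤ α) (hG : Continuous G) (B : ℝ) (n : ℕ) :
    Tame (majorant α γ η G x₀ B n) :=
  ((tame_sum_count_mul_velocity hα hG n).const_mul _).add
    (Tame.const_mul (Tame.sum _ fun k _ => tame_spread hα hG k) _)

lemma majorant_nonneg (hα : 0 ≤ α) (hη : 0 ≤ η) {B : ℝ} (hB : 0 ≤ B) (n : ℕ) (s : ℕ → ℝ) :
    0 ≤ majorant α γ η G x₀ B n s := by
  have h1 : 0 ≤ ∑ k ∈ Finset.range n, α * (chain α γ η G x₀ s (k + 1)).2.2 *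
      ‖(chain α γ η G x₀ s (k + 1)).2.1‖ := Finset.sum_nonneg fun k _ =>
    mul_nonneg (mul_nonneg hα (chain_count_nonneg s (k + 1))) (norm_nonneg _)
  have h2 : 0 ≤ ∑ k ∈ Finset.range n, spread α γ η G x₀ s k :=
    Finset.sum_nonneg fun k _ => spread_nonneg s k
  unfold majorant
  positivity

/-- Split (αh)² as α(αh) · h and spend the last h on the gradient bound. The factor αh is kept next
to the velocity, for Cauchy-Schwarz against Δ_n, and replaced by c next to the spread. -/
lemma iInf_mul_countSq_le {G' : E → E →L[ℝ] E} (hG' : ∀ x, HasFDerivAt G (G' x) x)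
    {L₂ : ℝ} (hL₂ : 0 ≤ L₂) (hlip : ∀ x y, ‖G' x - G' y‖ ≤ L₂ * ‖x - y‖) (hα : 0 ≤ α)
    (hη : 0 < η) {n : ℕ} {c : ℝ} (s : ℕ → ℝ)
    (hc : ∀ k < n, α * (chain α γ η G x₀ s (k + 1)).2.2 ≤ c) :
    (⨅ k : Icc 1 n, ‖G (chainAverage α γ η G x₀ s k)‖) * countSq α γ η G x₀ n s ≤
      majorant α γ η G x₀ (L₂ * α * c) n s := by
  rw [countSq, Finset.mul_sum, majorant, Finset.mul_sum, Finset.mul_sum, ← Finset.sum_add_distrib]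
  refine Finset.sum_le_sum fun k hk => ?_
  have hk : k < n := Finset.mem_range.1 hk
  have h1 : (⨅ k : Icc 1 n, ‖G (chainAverage α γ η G x₀ s k)‖) ≤
      ‖G (chainAverage α γ η G x₀ s (k + 1))‖ :=
    ciInf_le (f := fun k : Icc 1 n => ‖G (chainAverage α γ η G x₀ s k)‖)
      ⟨0, by rintro _ ⟨k, rfl⟩; exact norm_nonneg _⟩ ⟨k + 1, by omega, by omega⟩
  have h2 := count_mul_norm_grad_average_le (α := α) (γ := γ) (x₀ := x₀) hG' hL₂ hlip hη s k
  have h3 := chain_count_nonneg (α := α) (γ := γ) (η := η) (G := G) (x₀ := x₀) s (k + 1)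
  have h4 := spread_nonneg (α := α) (γ := γ) (η := η) (G := G) (x₀ := x₀) s k
  have h5 := hc k hk
  rw [← chainAverage] at h2
  set h := (chain α γ η G x₀ s (k + 1)).2.2
  set v := ‖(chain α γ η G x₀ s (k + 1)).2.1‖
  set D := spread α γ η G x₀ s k
  set g := ‖G (chainAverage α γ η G x₀ s (k + 1))‖
  calc _ ≤ g * (α * h) ^ 2 := by gcongr
    _ = α * (α * h) * (h * g) := by ring
    _ ≤ α * (α * h) * (v / η + L₂ * D) := by gcongr
    _ = α / η * (α * h * v) + α * (α * h) * (L₂ * D) := by ring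
    _ ≤ α / η * (α * h * v) + α * c * (L₂ * D) := by gcongr
    _ = _ := by ring

lemma IsPoissonClock.integral_countSq_mul_le (hτ : IsPoissonClock μ τ)
    (hfG : ∀ x, HasGradientAt f (G x) x) (hG : Continuous G)
    (hα : 0 < α) (hα1 : α ≤ 3 / 4) (hγ : 0 < γ) (hη : η = √(γ / 2))
    (hdesc : ∀ y, f (y - γ • G y) ≤ f y - γ / 2 * ‖G y‖ ^ 2) (hm : ∀ x, m ≤ f x)
    {n : ℕ} (hn : (n : ℝ) * α ^ 7 = 1) (hD : 0 < ∫ ω, countSq α γ η G x₀ n (fun i => τ i ω) ∂μ) :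
    ∫ ω, ∑ k ∈ Finset.range n, α * (chain α γ η G x₀ (fun i => τ i ω) (k + 1)).2.2 *
      ‖(chain α γ η G x₀ (fun i => τ i ω) (k + 1)).2.1‖ ∂μ ≤
      √((∫ ω, countSq α γ η G x₀ n (fun i => τ i ω) ∂μ) * (9 / 2 * (f x₀ - m) / α)) := by
  have hδ : 0 ≤ f x₀ - m := sub_nonneg.2 (hm x₀)
  refine le_sqrt_mul_of_forall hD (by positivity) fun ε hε => ?_
  have hv := fun k => (tame_norm_velocity (γ := γ) (η := η) (x₀ := x₀) hα.le hG k).pow 2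
  have hV : ∫ ω, ∑ k ∈ Finset.range n,
      ‖(chain α γ η G x₀ (fun i => τ i ω) (k + 1)).2.1‖ ^ 2 ∂μ ≤ 9 / 2 * (f x₀ - m) / α := by
    rw [integral_finsetSum _ fun k _ => (hv (k + 1)).integrable hτ, le_div_iff₀' hα]
    exact hτ.sum_integral_velocity_sq_le hfG hG hα hα1 hγ hη hdesc hm hn
  have i1 := ((tame_countSq (γ := γ) (η := η) (x₀ := x₀) hα.le hG n).const_mul
    (ε / 2)).integrable hτ
  have i2 := ((Tame.sum (Finset.range n) fun k _ => hv (k + 1)).const_mul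
    (1 / (2 * ε))).integrable hτ
  have i0 := (tame_sum_count_mul_velocity (γ := γ) (η := η) (x₀ := x₀) hα.le hG n).integrable hτ
  have h := integral_mono i0 (i1.add i2) fun ω => by
    simp only [Pi.add_apply, countSq, Finset.mul_sum, ← Finset.sum_add_distrib]
    refine Finset.sum_le_sum fun k _ => ?_
    set a := α * (chain α γ η G x₀ (fun i => τ i ω) (k + 1)).2.2
    set b := ‖(chain α γ η G x₀ (fun i => τ i ω) (k + 1)).2.1‖
    have h1 : ε / 2 * a ^ 2 + 1 / (2 * ε) * b ^ 2 - a * b = 1 / (2 * ε) * (ε * a - b) ^ 2 := by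
      field_simp
      ring
    have h2 : 0 ≤ 1 / (2 * ε) * (ε * a - b) ^ 2 := by positivity
    linarith
  have h' := integral_add i1 i2
  rw [integral_const_mul, integral_const_mul] at h'
  refine h.trans (h'.le.trans ?_)
  gcongr

/-- With D the mean of `countSq` and D ≥ 3/5·(1+α)²α^{-7}, both α√(D/α) and α·α^{-4} become O(α⁴D).
The factor (1+α)² in that bound absorbs the one of the spread term. -/
lemma IsPoissonClock.integral_majorant_le (hτ : IsPoissonClock μ τ)
    (hfG : ∀ x, HasGradientAt f (G x) x) (hG : Continuous G)
    (hα : 0 < α) (hα1 : α ≤ 3 / 4) (hγ : 0 < γ) (hη : η = √(γ / 2))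
    (hdesc : ∀ y, f (y - γ • G y) ≤ f y - γ / 2 * ‖G y‖ ^ 2) (hm : ∀ x, m ≤ f x)
    {n : ℕ} (hn : (n : ℝ) * α ^ 7 = 1) {C L₂ : ℝ} (hC : 0 ≤ C) (hL₂ : 0 ≤ L₂) :
    ∫ ω, majorant α γ η G x₀ (L₂ * α * (C * (1 + α))) n (fun i => τ i ω) ∂μ ≤
      boundConst γ C L₂ (f x₀ - m) * α ^ 4 *
        ∫ ω, countSq α γ η G x₀ n (fun i => τ i ω) ∂μ := by
  have hδ : 0 ≤ f x₀ - m := sub_nonneg.2 (hm x₀)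
  have hη0 : 0 < η := by rw [hη]; positivity
  have hDle := hτ.le_integral_sum_count_sq (γ := γ) (η := η) (x₀ := x₀) hα hα1 hG hn
  change _ ≤ ∫ ω, countSq α γ η G x₀ n (fun i => τ i ω) ∂μ at hDle
  have hn0 : (0 : ℝ) < n := by
    by_contra hc
    have : (n : ℝ) = 0 := le_antisymm (not_lt.1 hc) n.cast_nonneg
    rw [this, zero_mul] at hn
    exact zero_ne_one hn
  have hnα : (n : ℝ) = 1 / α ^ 7 := by rw [eq_div_iff (by positivity)]; exact hn
  set D := ∫ ω, countSq α γ η G x₀ n (fun i => τ i ω) ∂μ with hDdef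
  have hD : 0 < D := lt_of_lt_of_le (by positivity) hDle
  have hfirst := hτ.integral_countSq_mul_le (x₀ := x₀) hfG hG hα hα1 hγ hη hdesc hm hn hD
  have hsecond := hτ.sum_integral_spread_le (x₀ := x₀) hfG hG hα hα1 hγ hη hdesc hm hn
  have i1 := ((tame_sum_count_mul_velocity (γ := γ) (η := η) (x₀ := x₀) hα.le hG n).const_mul
    (α / η)).integrable hτ
  have hsp := tame_spread (γ := γ) (η := η) (x₀ := x₀) hα.le hG
  have i2 := (Tame.const_mul (Tame.sum (Finset.range n) fun k _ => hsp k)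
    (L₂ * α * (C * (1 + α)))).integrable hτ
  have hsplit := integral_add i1 i2
  rw [integral_const_mul, integral_const_mul,
    integral_finsetSum _ fun k _ => (hsp k).integrable hτ] at hsplit
  refine hsplit.le.trans ?_
  have h1 : α / η * √(D * (9 / 2 * (f x₀ - m) / α)) ≤
      6 * √(2 * (1 + 3 / 2) / γ) * √(f x₀ - m) * α ^ 4 * D := by
    rw [mul_assoc 6, ← Real.sqrt_mul (by positivity)]
    have hD1 : 3 / 5 / α ^ 7 ≤ D := by
      refine le_trans ?_ hDle
      rw [hnα]
      have : (1 : ℝ) ≤ (1 + α) ^ 2 := by nlinarith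
      calc (3 / 5 / α ^ 7 : ℝ) = 3 / 5 * 1 * (1 / α ^ 7) := by ring
        _ ≤ _ := by gcongr
    have hη2 : η ^ 2 = γ / 2 := by rw [hη]; exact Real.sq_sqrt (by positivity)
    refine abs_le_of_sq_le_sq' ?_ (by positivity) |>.2
    rw [mul_pow, div_pow, Real.sq_sqrt (by positivity), mul_pow, mul_pow, mul_pow,
      Real.sq_sqrt (by positivity), hη2]
    have h2 : 1 ≤ 5 / 3 * α ^ 7 * D := by
      have := mul_le_mul_of_nonneg_left hD1 (by positivity : 0 ≤ 5 / 3 * α ^ 7)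
      calc (1 : ℝ) = 5 / 3 * α ^ 7 * (3 / 5 / α ^ 7) := by field_simp
        _ ≤ _ := this
    calc α ^ 2 / (γ / 2) * (D * (9 / 2 * (f x₀ - m) / α))
        = 9 * α * (f x₀ - m) / γ * D * 1 := by field_simp
      _ ≤ 9 * α * (f x₀ - m) / γ * D * (5 / 3 * α ^ 7 * D) := by gcongr
      _ = 15 * ((f x₀ - m) / γ * (α ^ 4) ^ 2 * D ^ 2) := by ring
      -- The square of the target constant gives 180 = 6² · 2 · (5/2).
      _ ≤ 180 * ((f x₀ - m) / γ * (α ^ 4) ^ 2 * D ^ 2) := by gcongr; norm_num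
      _ = _ := by ring
  have h2 : L₂ * α * (C * (1 + α)) * (216 * (1 + α) * (α + 2) * γ / α ^ 4 * (f x₀ - m)) ≤
      25 / 2 * 3 ^ 4 * C * L₂ * γ * (f x₀ - m) * α ^ 4 * D := by
    calc _ = 360 * (α + 2) * (C * L₂ * γ * (f x₀ - m)) * α ^ 4 *
          (3 / 5 * (1 + α) ^ 2 * n) := by
          rw [hnα]
          field_simp
          ring
      _ ≤ 25 / 2 * 3 ^ 4 * (C * L₂ * γ * (f x₀ - m)) * α ^ 4 * D := by
          -- With α ≤ 3/4 the left side is at most 990, against 1012.5.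
          have h3 : 360 * (α + 2) ≤ 25 / 2 * 3 ^ 4 := by linarith
          exact mul_le_mul (mul_le_mul_of_nonneg_right (mul_le_mul_of_nonneg_right h3
            (by positivity)) (by positivity)) hDle (by positivity) (by positivity)
      _ = _ := by ring
  have h3 : α / η * ∫ ω, ∑ k ∈ Finset.range n,
      α * (chain α γ η G x₀ (fun i => τ i ω) (k + 1)).2.2 *
      ‖(chain α γ η G x₀ (fun i => τ i ω) (k + 1)).2.1‖ ∂μ ≤
      α / η * √(D * (9 / 2 * (f x₀ - m) / α)) := by gcongr
  have h4 : L₂ * α * (C * (1 + α)) * ∑ k ∈ Finset.range n,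
      ∫ ω, spread α γ η G x₀ (fun i => τ i ω) k ∂μ ≤
      L₂ * α * (C * (1 + α)) * (216 * (1 + α) * (α + 2) * γ / α ^ 4 * (f x₀ - m)) := by gcongr
  rw [boundConst, add_mul, add_mul]
  linarith

lemma measurableSet_goodSet {T : ℕ → Ω → ℝ} (hT : ∀ k, Measurable (T k)) (C α : ℝ) (n : ℕ) :
    MeasurableSet (goodSet μ T C α n) := by
  have h0 : ∀ i, Measurable fun ω => H0 α (fun k => T k ω) i := fun i => by
    unfold H0; fun_prop
  have h1 : ∀ i, Measurable fun ω => H1 α (fun k => T k ω) i := fun i => by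
    unfold H1; fun_prop
  have h2 : ∀ i, Measurable fun ω => H2 α (fun k => T k ω) i := fun i => by
    unfold H2; fun_prop
  have : goodSet μ T C α n = ⋂ i ∈ Finset.Icc 1 n,
      ({ω | H0 α (fun k => T k ω) i ≤ C * ∫ ω', H0 α (fun k => T k ω') i ∂μ} ∩
      ({ω | H1 α (fun k => T k ω) i ≤ C * ∫ ω', H1 α (fun k => T k ω') i ∂μ} ∩
      {ω | H2 α (fun k => T k ω) i ≤ C * α⁻¹ * ∫ ω', H2 α (fun k => T k ω') i ∂μ})) := by
    ext ω
    simp [goodSet]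
  rw [this]
  exact Finset.measurableSet_biInter _ fun i _ =>
    (measurableSet_le (h0 i) measurable_const).inter
      ((measurableSet_le (h1 i) measurable_const).inter (measurableSet_le (h2 i) measurable_const))

lemma weighted_min_gradient (hfG : ∀ x, HasGradientAt f (G x) x) (hG : Continuous G) (hγ : 0 < γ)
    (hdesc : ∀ y, f (y - γ • G y) ≤ f y - γ / 2 * ‖G y‖ ^ 2) (hm : ∀ x, m ≤ f x)
    {G' : E → E →L[ℝ] E} (hG' : ∀ x, HasFDerivAt G (G' x) x) {C L₂ : ℝ} (hC : 0 ≤ C)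
    (hL₂ : 0 ≤ L₂) (hlip : ∀ x y, ‖G' x - G' y‖ ≤ L₂ * ‖x - y‖) (x₀ : E)
    {T : ℕ → Ω → ℝ} (hTm : ∀ k, Measurable (T k)) (hT0 : ∀ ω, T 0 ω = 0)
    (hT : IsPoissonClock μ fun k ω => T (k + 1) ω - T k ω) {n : ℕ} (hn : 8 ≤ n) :
    0 < ∫ ω, delta (rate n) (fun k => T k ω) n ∂μ ∧
    Integrable (weighted μ T C n fun ω => ⨅ k : Icc 1 n,
      ‖G (xbar (tuned γ n) (rate n) G x₀ (fun j => T j ω) k)‖) μ ∧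
    ∫ ω, weighted μ T C n (fun ω => ⨅ k : Icc 1 n,
      ‖G (xbar (tuned γ n) (rate n) G x₀ (fun j => T j ω) k)‖) ω ∂μ
      ≤ boundConst γ C L₂ (f x₀ - m) * (n : ℝ) ^ (-(4 / 7) : ℝ) := by
  have hα := rate_pos hn
  have hα1 := rate_le hn
  have hnα := mul_rate_pow hn
  rw [← rate_pow_four]
  generalize hη : √(γ / 2) = η
  have hη0 : 0 < η := by rw [← hη]; positivity
  let s : Ω → ℕ → ℝ := fun ω i => T (i + 1) ω - T i ω
  have htime : ∀ ω, (fun k => T k ω) = time (s ω) := by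
    intro ω
    funext k
    rw [time, Finset.sum_range_sub (fun i => T i ω), hT0, sub_zero]
  have hH1 : ∀ ω k, H1 (rate n) (fun k => T k ω) k = (chain (rate n) γ η G x₀ (s ω) k).2.2 :=
    fun ω k => by rw [htime]; exact H1_time _ _
  have hpos : ∀ᵐ ω ∂μ, ∀ k, 0 < s ω k := hT.ae_pos
  have hdelta : ∀ᵐ ω ∂μ, delta (rate n) (fun k => T k ω) n =
      countSq (rate n) γ η G x₀ n (s ω) := by
    filter_upwards [hpos] with ω hω
    rw [htime, delta_eq (strictMono_time hω) (time_zero _), countSq]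
    simp_rw [H1_time (G := G) (γ := γ) (η := η) (x₀ := x₀)]
  have hxbar : ∀ᵐ ω ∂μ, ∀ k, xbar (tuned γ n) (rate n) G x₀ (fun j => T j ω) k =
      chainAverage (rate n) γ η G x₀ (s ω) k := by
    -- The only waiting time at which the denominator of the z̃ update can vanish.
    filter_upwards [hT.ae_ne (-Real.log (-(rate n - η) / η) / rate n)] with ω hω k
    rw [htime, xbar, chainAverage]
    congr 1
    funext i
    refine (xz_eq_chain (by simp [tuned]) hα.ne' rfl hη (by simp [tuned, hη]) ?_ i).2
    intro i h
    refine hω i ?_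
    simp only [tuned, hη] at h
    have h1 : -(rate n - η) / η = Real.exp (-rate n * s ω i) := by
      rw [div_eq_iff hη0.ne']; linarith
    rw [h1, Real.log_exp]
    change s ω i = _
    field_simp
  set D := ∫ ω, countSq (rate n) γ η G x₀ n (s ω) ∂μ with hD
  have hDelta : ∫ ω, delta (rate n) (fun k => T k ω) n ∂μ = D := integral_congr_ae hdelta
  have hDle := hT.le_integral_sum_count_sq (γ := γ) (η := η) (x₀ := x₀) hα hα1 hG hnα
  have hD0 : 0 < D := by
    have hn0 : (0 : ℝ) < n := by exact_mod_cast (by omega : 0 < n)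
    exact lt_of_lt_of_le (by positivity) hDle
  let W : Ω → ℝ := (goodSet μ T C (rate n) n).indicator fun ω =>
    (⨅ k : Icc 1 n, ‖G (chainAverage (rate n) γ η G x₀ (s ω) k)‖) *
      (countSq (rate n) γ η G x₀ n (s ω) / D)
  have hW : weighted μ T C n (fun ω => ⨅ k : Icc 1 n,
      ‖G (xbar (tuned γ n) (rate n) G x₀ (fun j => T j ω) k)‖) =ᵐ[μ] W := by
    filter_upwards [hdelta, hxbar] with ω h1 h2
    simp only [weighted, W, indicator, hDelta, h1, h2]
  have hsm : Measurable s := measurable_pi_lambda _ hT.meas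
  have hGm : Measurable fun x => ‖G x‖ := hG.norm.measurable
  have hcm : Measurable fun ω => countSq (rate n) γ η G x₀ n (s ω) :=
    (tame_countSq hα.le hG n).1.comp hsm
  have hWm : AEStronglyMeasurable W μ := by
    refine (Measurable.indicator ?_ (measurableSet_goodSet hTm _ _ _)).aestronglyMeasurable
    refine Measurable.mul (Measurable.iInf fun k => ?_) (hcm.div_const D)
    exact (hGm.comp (measurable_chainAverage hα.le hG k)).comp hsm
  let R : (ℕ → ℝ) → ℝ := majorant (rate n) γ η G x₀ (L₂ * rate n * (C * (1 + rate n))) n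
  have hRt : Tame R := tame_majorant hα.le hG _ n
  have hRi : Integrable (fun ω => R (s ω) / D) μ := (hRt.integrable hT).div_const D
  have hcsq : ∀ ω, 0 ≤ countSq (rate n) γ η G x₀ n (s ω) := fun ω =>
    Finset.sum_nonneg fun k _ => sq_nonneg _
  have hW0 : ∀ ω, 0 ≤ W ω := fun ω => indicator_nonneg (fun ω _ =>
    mul_nonneg (Real.iInf_nonneg fun k => norm_nonneg _) (div_nonneg (hcsq ω) hD0.le)) ω
  have hWR : ∀ ω, W ω ≤ R (s ω) / D := by
    intro ω
    have hR0 : 0 ≤ R (s ω) := majorant_nonneg hα.le hη0.le (by positivity) n (s ω)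
    by_cases hω : ω ∈ goodSet μ T C (rate n) n
    · simp only [W, indicator_of_mem hω]
      rw [← mul_div_assoc]
      gcongr
      refine iInf_mul_countSq_le hG' hL₂ hlip hα.le hη0 (s ω) fun k hk => ?_
      -- The event bounds h by C times its mean, which is at most (1+α)/α; hence αh ≤ C(1+α).
      have h1 := (hω (k + 1) (by simp; omega)).2.1
      simp only [hH1] at h1
      have h2 := hT.integral_count_le (γ := γ) (η := η) (x₀ := x₀) hα hG (k + 1)
      have h3 := mul_le_mul_of_nonneg_left (h1.trans (mul_le_mul_of_nonneg_left h2 hC)) hα.le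
      refine h3.trans (le_of_eq ?_)
      field_simp
    · simp only [W, indicator_of_notMem hω]
      positivity
  have hWi : Integrable W μ := hRi.mono' hWm (ae_of_all _ fun ω => by
    rw [Real.norm_of_nonneg (hW0 ω)]; exact hWR ω)
  refine ⟨hDelta ▸ hD0, hWi.congr hW.symm, ?_⟩
  rw [integral_congr_ae hW]
  refine (integral_mono hWi hRi hWR).trans ?_
  rw [integral_div, div_le_iff₀ hD0]
  exact hT.integral_majorant_le hfG hG hα hα1 hγ hη.symm hdesc hm hnα hC hL₂

end Main

/-- The number of iterations that brings the bound below `ε`. -/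
lemma exists_iterations {K ε : ℝ} (hK : 0 ≤ K) (hε : 0 < ε) : ∃ n : ℕ, 8 ≤ n ∧
    ((2 * n : ℕ) : ℝ) ≤ 18 + 2 * (K / ε) ^ (7 / 4 : ℝ) ∧
    K * (n : ℝ) ^ (-(4 / 7) : ℝ) ≤ ε := by
  have hq : 0 ≤ K / ε := by positivity
  have hq' : 0 ≤ (K / ε) ^ (7 / 4 : ℝ) := by positivity
  -- This n is at most 9 + (K/ε)^{7/4}, and the cost is 2n: one evaluation per iteration and one per
  -- candidate point.
  refine ⟨max 8 ⌈(K / ε) ^ (7 / 4 : ℝ)⌉₊, le_max_left _ _, ?_, ?_⟩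
  · push_cast
    have h1 := Nat.ceil_lt_add_one hq'
    have h2 : max (8 : ℝ) (⌈(K / ε) ^ (7 / 4 : ℝ)⌉₊ : ℝ) ≤ 9 + (K / ε) ^ (7 / 4 : ℝ) :=
      max_le (by linarith) (by linarith)
    linarith
  · set n := max 8 ⌈(K / ε) ^ (7 / 4 : ℝ)⌉₊
    have hn : (K / ε) ^ (7 / 4 : ℝ) ≤ n :=
      (Nat.le_ceil _).trans (by exact_mod_cast le_max_right _ _)
    have hn0 : (0 : ℝ) < n := by
      have : 8 ≤ n := le_max_left _ _
      exact_mod_cast (by omega : 0 < n)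
    have h1 : K / ε ≤ (n : ℝ) ^ (4 / 7 : ℝ) := by
      have := Real.rpow_le_rpow hq' hn (by norm_num : (0 : ℝ) ≤ 4 / 7)
      rw [← Real.rpow_mul hq] at this
      norm_num at this
      exact this
    rw [Real.rpow_neg hn0.le, ← div_eq_mul_inv, div_le_iff₀ (by positivity)]
    rw [div_le_iff₀ hε] at h1
    linarith

lemma boundConst_nonneg {γ C L₂ δ : ℝ} (hγ : 0 ≤ γ) (hC : 0 ≤ C) (hL₂ : 0 ≤ L₂) (hδ : 0 ≤ δ) :
    0 ≤ boundConst γ C L₂ δ := by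
  unfold boundConst
  positivity

end CNA

end

theorem mainTheorem1 {d : ℕ} (f : EuclideanSpace ℝ (Fin d) → ℝ)
    (hf : Differentiable ℝ f) (hf' : Differentiable ℝ (gradient f))
    (hbdd : BddBelow (Set.range f))
    {L L₂ : ℝ} (hL : 0 < L) (hL₂ : 0 ≤ L₂)
    (hgrad : ∀ x y, ‖gradient f x - gradient f y‖ ≤ L * ‖x - y‖)
    (hhess : ∀ x y, ‖fderiv ℝ (gradient f) x - fderiv ℝ (gradient f) y‖ ≤ L₂ * ‖x - y‖)
    {γ C : ℝ} (hγ : 0 < γ) (hγL : γ ≤ 1 / L) (hC : 0 < C)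
    (x₀ : EuclideanSpace ℝ (Fin d))
    {Ω : Type*} [MeasurableSpace Ω] (μ : Measure Ω) [IsProbabilityMeasure μ]
    (T : ℕ → Ω → ℝ) (hTm : ∀ k, Measurable (T k)) (hT0 : ∀ ω, T 0 ω = 0)
    (hTindep : iIndepFun (fun (k : ℕ) (ω : Ω) => T (k + 1) ω - T k ω) μ)
    (hTlaw : ∀ k, μ.map (fun ω => T (k + 1) ω - T k ω) = expMeasure 1) :
    (∀ n : ℕ, 8 ≤ n →
      0 < ∫ ω, CNA.delta (CNA.rate n) (fun k => T k ω) n ∂μ ∧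
      Integrable (CNA.weighted μ T C n fun ω => ⨅ k : Set.Icc 1 n,
        ‖gradient f (CNA.xbar (CNA.tuned γ n) (CNA.rate n) (gradient f) x₀
          (fun j => T j ω) k)‖) μ ∧
      ∫ ω, CNA.weighted μ T C n (fun ω => ⨅ k : Set.Icc 1 n,
        ‖gradient f (CNA.xbar (CNA.tuned γ n) (CNA.rate n) (gradient f) x₀
          (fun j => T j ω) k)‖) ω ∂μ
        ≤ CNA.boundConst γ C L₂ (f x₀ - ⨅ x, f x) * (n : ℝ) ^ (-(4 / 7) : ℝ)) ∧
    (∀ ε : ℝ, 0 < ε → ∃ n : ℕ, 8 ≤ n ∧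
      (∀ ω, ((CNA.program (CNA.tuned γ n) (CNA.rate n) x₀ (fun j => T j ω) n).evals
          (gradient f) : ℝ)
        ≤ 18 + 2 * (CNA.boundConst γ C L₂ (f x₀ - ⨅ x, f x) / ε) ^ (7 / 4 : ℝ)) ∧
      Integrable (CNA.weighted μ T C n fun ω =>
        ‖gradient f ((CNA.program (CNA.tuned γ n) (CNA.rate n) x₀ (fun j => T j ω) n).result
          (gradient f))‖) μ ∧
      ∫ ω, CNA.weighted μ T C n (fun ω =>
        ‖gradient f ((CNA.program (CNA.tuned γ n) (CNA.rate n) x₀ (fun j => T j ω) n).result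
          (gradient f))‖) ω ∂μ ≤ ε) := by
  have hLγ : L * γ ≤ 1 := by rwa [le_div_iff₀' hL] at hγL
  have hfG : ∀ x, HasGradientAt f (gradient f x) x := fun x => (hf x).hasGradientAt
  have hdesc := CNA.descent hfG hgrad hγ.le hLγ
  have hm : ∀ x, ⨅ y, f y ≤ f x := fun x => ciInf_le hbdd x
  have hclock : CNA.IsPoissonClock μ fun k ω => T (k + 1) ω - T k ω :=
    ⟨fun k => (hTm (k + 1)).sub (hTm k), hTindep, hTlaw⟩
  have main := fun (n : ℕ) (hn : 8 ≤ n) => CNA.weighted_min_gradient hfG hf'.continuous hγ hdesc hm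
    (fun x => (hf' x).hasFDerivAt) hC.le hL₂ hhess x₀ hTm hT0 hclock hn
  refine ⟨main, fun ε hε => ?_⟩
  obtain ⟨n, hn, hcost, hbound⟩ := CNA.exists_iterations
    (CNA.boundConst_nonneg hγ.le hC.le hL₂ (sub_nonneg.2 (hm x₀))) hε
  have hn1 : 1 ≤ n := by omega
  refine ⟨n, hn, fun ω => ?_, ?_⟩
  · rw [CNA.evals_program _ _ _ _ _ hn1]
    exact hcost
  · simp_rw [CNA.norm_grad_result_program _ _ _ _ _ hn1]
    exact ⟨(main n hn).2.1, (main n hn).2.2.trans hbound⟩
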